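/- Let $X,\widehat X$ be smooth $n$-dimensional manifolds with smooth metrics $g,\widehat g$ (symmetric and nondegenerate, of any signature), and equip $M=X\times\widehat X$ with the metric $G=g\oplus(-\widehat g)$. Let $e:Y\to M$ be a smooth embedding of a $k$-dimensional manifold, so that $TY\subseteq e^*TM$, and let $F$ be a smooth closed 2-form on $Y$. Assume that $(Y,F)$ is a topological bibrane: whenever $u\in T_yY$ and $v\in T_{e(y)}M$ satisfy $G(v,w)=F(u,w)$ for all $w\in T_yY$, then $v\in T_yY$ and $G(u,w)=F(v,w)$ for all $w\in T_yY$. Put $$\mathcal R_+=\{u\in TY:\ G(u,w)=F(u,w)\ \text{for all } w\in TY\},$$ and assume that the distribution $\mathcal R_+$ on $Y$ is integrable, i.e. through every point of $Y$ there passes an integral submanifold of $\mathcal R_+$. Let $\Lambda$ be an associative real normed algebra, in which the fermions have their coefficients (for example a Grassmann algebra, the fermions being odd). A field configuration along the defect line $D$ consists of a map $\phi:D\to Y\subseteq M$ and a field $\psi$ along it with $\psi(\sigma)\in\Lambda\otimes\mathcal R_+|_{\phi(\sigma)}\subseteq\Lambda\otimes T_{\phi(\sigma)}M$ for $\sigma\in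 D$. An allowed variation is a one-parameter family $(\phi_t,\psi_t)$, $t\in\mathbb R$, of such configurations, differentiable in $t$ at $t=0$ for each $\sigma\in D$; in local coordinates on $M$ write $\phi^I,\psi^I$ for the components of $(\phi_0,\psi_0)$ and $\delta\phi^I=\frac{d}{dt}\big|_{t=0}\phi_t^I$, $\delta\psi^I=\frac{d}{dt}\big|_{t=0}\psi_t^I$ (so $\delta\phi$ is tangent to $Y$), and $$\delta^{\rm cov}\psi^I=\delta\psi^I+\delta\phi^J\,\Gamma^I_{JK}\,\psi^K ,$$ where $\Gamma^I_{JK}$ are the Christoffel symbols of the Levi-Civita connection of $G$. Then for every allowed variation, at every point $\sigma\in D$, and in every smooth coordinate chart of $M$ around $\phi_0(\sigma)$, $$G_{IJ}\,\psi^I\,\delta^{\rm cov}\psi^J=0 .$$ -/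

import Mathlib

open scoped Manifold ContDiff TensorProduct Topology

noncomputable section

namespace Bibrane

/-! ### Bilinear forms on manifolds and their components in charts -/

section Local

variable {E : Type*} [NormedAddCommGroup E] [NormedSpace ℝ E]
  {H : Type*} [TopologicalSpace H] (I : ModelWithCorners ℝ E H)
  {M : Type*} [TopologicalSpace M] [ChartedSpace H M]

/-- The tangent vector `a^J ∂_J`, at the point with coordinates `x` in the chart `c`, whose
components in the coordinates of `c` are those of `a : E`. -/
def coordVec (c : OpenPartialHomeomorph M H) (x : E) (a : E) :
    TangentSpace I ((c.extend I).symm x) :=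
  mfderiv 𝓘(ℝ, E) I (c.extend I).symm x a

/-- The coordinate expression, in the chart `c`, of a field `B` of bilinear forms. -/
def coordForm (B : ∀ p : M, TangentSpace I p → TangentSpace I p → ℝ)
    (c : OpenPartialHomeomorph M H) (x a b : E) : ℝ :=
  B ((c.extend I).symm x) (coordVec I c x a) (coordVec I c x b)

/-- The components `B_{JK}` in the chart `c`, with respect to a basis of the model space. -/
def coordMatrix {ι : Type*} (β : Module.Basis ι ℝ E)
    (B : ∀ p : M, TangentSpace I p → TangentSpace I p → ℝ)
    (c : OpenPartialHomeomorph M H) (x : E) : Matrix ι ι ℝ :=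
  Matrix.of fun J K => coordForm I B c x (β J) (β K)

/-- The Christoffel symbols of the Levi-Civita connection of `B` in the chart `c`:
`Γ^J_{KL} = ½ B^{JN} (∂_K B_{LN} + ∂_L B_{KN} - ∂_N B_{KL})`. -/
def christoffel {ι : Type*} [Fintype ι] [DecidableEq ι] (β : Module.Basis ι ℝ E)
    (B : ∀ p : M, TangentSpace I p → TangentSpace I p → ℝ)
    (c : OpenPartialHomeomorph M H) (x : E) (J K L : ι) : ℝ :=
  (1 / 2 : ℝ) * ∑ N, (coordMatrix I β B c x)⁻¹ J N *
    (fderiv ℝ (fun z => coordMatrix I β B c z L N) x (β K)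
      + fderiv ℝ (fun z => coordMatrix I β B c z K N) x (β L)
      - fderiv ℝ (fun z => coordMatrix I β B c z K L) x (β N))

/-- The component `v^J = dφ^J(v)` of a tangent vector in the chart `c`. -/
def vecComponent {ι : Type*} (β : Module.Basis ι ℝ E)
    (c : OpenPartialHomeomorph M H) (p : M) (J : ι) : TangentSpace I p →ₗ[ℝ] ℝ :=
  (β.coord J).comp (mfderiv I 𝓘(ℝ, E) (c.extend I) p).toLinearMap

/-- The component `ψ^J`, an element of the coefficient algebra `Λ`, of a tangent vector `ψ`
with coefficients in `Λ`, in the chart `c`. -/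
def fermionComponent {ι : Type*} (β : Module.Basis ι ℝ E)
    (Λ : Type*) [NormedRing Λ] [NormedAlgebra ℝ Λ]
    (c : OpenPartialHomeomorph M H) (p : M) (ψ : Λ ⊗[ℝ] TangentSpace I p) (J : ι) : Λ :=
  TensorProduct.rid ℝ Λ (LinearMap.lTensor Λ (vecComponent I β c p J) ψ)

/-- A smooth metric of arbitrary signature: a smooth field of symmetric nondegenerate
bilinear forms on the tangent spaces. -/
structure PseudoRiemannianMetric (M : Type*) [TopologicalSpace M] [ChartedSpace H M]
    [IsManifold I ∞ M] where
  form : ∀ p : M, TangentSpace I p →L[ℝ] TangentSpace I p →L[ℝ] ℝ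
  symm : ∀ p u v, form p u v = form p v u
  nondegenerate : ∀ p u, (∀ v, form p u v = 0) → u = 0
  contMDiff : ContMDiff I (I.prod 𝓘(ℝ, E →L[ℝ] E →L[ℝ] ℝ)) ∞
    (fun p => Bundle.TotalSpace.mk' (E →L[ℝ] E →L[ℝ] ℝ)
      (E := fun p : M => TangentSpace I p →L[ℝ] TangentSpace I p →L[ℝ] ℝ) p (form p))

/-- A smooth closed 2-form (on a manifold without boundary). In every chart,
closedness reads `∂_a F(b, d) + ∂_b F(d, a) + ∂_d F(a, b) = 0`. -/
structure ClosedTwoForm (M : Type*) [TopologicalSpace M] [ChartedSpace H M]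
    [IsManifold I ∞ M] where
  form : ∀ p : M, TangentSpace I p →L[ℝ] TangentSpace I p →L[ℝ] ℝ
  alternating : ∀ p u, form p u u = 0
  contMDiff : ContMDiff I (I.prod 𝓘(ℝ, E →L[ℝ] E →L[ℝ] ℝ)) ∞
    (fun p => Bundle.TotalSpace.mk' (E →L[ℝ] E →L[ℝ] ℝ)
      (E := fun p : M => TangentSpace I p →L[ℝ] TangentSpace I p →L[ℝ] ℝ) p (form p))
  closed : ∀ c ∈ atlas H M, ∀ x ∈ (c.extend I).target, ∀ a b d : E,
    fderiv ℝ (fun z => coordForm I (fun p u v => form p u v) c z b d) x a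
      + fderiv ℝ (fun z => coordForm I (fun p u v => form p u v) c z d a) x b
      + fderiv ℝ (fun z => coordForm I (fun p u v => form p u v) c z a b) x d = 0

/-- A distribution `Δ` (a field of subspaces of the tangent spaces) is integrable if through
every point there passes an integral submanifold of `Δ`, given by a smooth immersion `j` of an
open neighbourhood of the origin of some `ℝ^r` whose tangent spaces are the spaces of `Δ`. -/
def IsIntegrable (Δ : ∀ p : M, Submodule ℝ (TangentSpace I p)) : Prop :=
  ∀ p : M, ∃ (r : ℕ) (U : Set (EuclideanSpace ℝ (Fin r))) (j : EuclideanSpace ℝ (Fin r) → M),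
    IsOpen U ∧ 0 ∈ U ∧ j 0 = p ∧ ContMDiffOn (𝓡 r) I ∞ j U ∧
    ∀ x ∈ U, Function.Injective (mfderiv (𝓡 r) I j x) ∧
      LinearMap.range (mfderiv (𝓡 r) I j x).toLinearMap = Δ (j x)

end Local

/-! ### Bibranes in the product of two targets -/

/-- The model with corners of `X × X'` for `n`-manifolds `X`, `X'`. -/
abbrev prodModel (n : ℕ) :
    ModelWithCorners ℝ (EuclideanSpace ℝ (Fin n) × EuclideanSpace ℝ (Fin n))
      (ModelProd (EuclideanSpace ℝ (Fin n)) (EuclideanSpace ℝ (Fin n))) :=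
  (𝓡 n).prod (𝓡 n)

/-- The standard basis of `ℝⁿ × ℝⁿ`; its index set consists of the indices `i` of `X`
followed by those of `X'`. -/
def prodBasis (n : ℕ) : Module.Basis (Fin n ⊕ Fin n) ℝ
    (EuclideanSpace ℝ (Fin n) × EuclideanSpace ℝ (Fin n)) :=
  (EuclideanSpace.basisFun (Fin n) ℝ).toBasis.prod (EuclideanSpace.basisFun (Fin n) ℝ).toBasis

section Product

variable {n k : ℕ}
  {X : Type*} [TopologicalSpace X] [ChartedSpace (EuclideanSpace ℝ (Fin n)) X]
  [IsManifold (𝓡 n) ∞ X]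
  {X' : Type*} [TopologicalSpace X'] [ChartedSpace (EuclideanSpace ℝ (Fin n)) X']
  [IsManifold (𝓡 n) ∞ X']
  {Y : Type*} [TopologicalSpace Y] [ChartedSpace (EuclideanSpace ℝ (Fin k)) Y]
  [IsManifold (𝓡 k) ∞ Y]

/-- The metric `G = g ⊕ (-g')` on `X × X'`. -/
def productMetric (g : PseudoRiemannianMetric (𝓡 n) X) (g' : PseudoRiemannianMetric (𝓡 n) X')
    (p : X × X') : LinearMap.BilinForm ℝ (TangentSpace (prodModel n) p) :=
  LinearMap.mk₂ ℝ
    (fun u v =>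
      g.form p.1 (mfderiv (prodModel n) (𝓡 n) Prod.fst p u)
          (mfderiv (prodModel n) (𝓡 n) Prod.fst p v)
        - g'.form p.2 (mfderiv (prodModel n) (𝓡 n) Prod.snd p u)
          (mfderiv (prodModel n) (𝓡 n) Prod.snd p v))
    (by intro u v w; simp only [map_add, add_apply]; ring)
    (by intro a u w; simp only [map_smul, smul_apply, smul_eq_mul]; ring)
    (by intro u v w; simp only [map_add]; ring)
    (by intro a u w; simp only [map_smul, smul_eq_mul]; ring)

variable (g : PseudoRiemannianMetric (𝓡 n) X) (g' : PseudoRiemannianMetric (𝓡 n) X')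
  (F : ClosedTwoForm (𝓡 k) Y) (e : Y → X × X')

/-- The differential `T_y Y → T_{e y} (X × X')` of the embedding. -/
def pushforward (y : Y) : TangentSpace (𝓡 k) y →ₗ[ℝ] TangentSpace (prodModel n) (e y) :=
  (mfderiv (𝓡 k) (prodModel n) e y).toLinearMap

/-- `(Y, F)` is a topological bibrane: whenever `u ∈ T_y Y` and `v ∈ T_{e y} (X × X')` satisfy
`G(v, w) = F(u, w)` for all `w ∈ T_y Y`, then `v` is tangent to `Y` and
`G(u, w) = F(v, w)` for all `w ∈ T_y Y`. -/
def IsTopologicalBibrane : Prop :=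
  ∀ (y : Y) (u : TangentSpace (𝓡 k) y) (v : TangentSpace (prodModel n) (e y)),
    (∀ w, productMetric g g' (e y) v (pushforward e y w) = F.form y u w) →
    ∃ v' : TangentSpace (𝓡 k) y, pushforward e y v' = v ∧
      ∀ w, productMetric g g' (e y) (pushforward e y u) (pushforward e y w) = F.form y v' w

/-- `R₊ = {u ∈ TY : G(u, w) = F(u, w) for all w ∈ TY}`, as a field of subspaces of `TY`. -/
def Rplus (y : Y) : Submodule ℝ (TangentSpace (𝓡 k) y) where
  carrier := {u | ∀ w, productMetric g g' (e y) (pushforward e y u) (pushforward e y w)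
    = F.form y u w}
  add_mem' := by
    intro a b ha hb w
    simp only [map_add, LinearMap.add_apply, add_apply, ha w, hb w]
  zero_mem' := by intro w; simp
  smul_mem' := by
    intro r a ha w
    simp only [map_smul, LinearMap.smul_apply, smul_apply, ha w]

/-- `R₊` regarded as a field of subspaces of the pullback bundle `e^* T(X × X')`. -/
def RplusTarget (y : Y) : Submodule ℝ (TangentSpace (prodModel n) (e y)) :=
  (Rplus g g' F e y).map (pushforward e y)

/-- An allowed variation of the fields along the defect line `D`: a one-parameter family
`(φ_t, ψ_t)`, differentiable in `t` at `t = 0`, of fields satisfying the gluing conditions that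
`φ_t` is valued in `Y` and the fermion `ψ_t` in `R₊`. Fermions have coefficients in `Λ`, which is
allowed to be any normed algebra, for instance a Grassmann algebra. -/
structure AllowedVariation (Λ : Type*) [NormedRing Λ] [NormedAlgebra ℝ Λ] (D : Type*) where
  φ : ℝ → D → Y
  ψ : ∀ (t : ℝ) (σ : D), Λ ⊗[ℝ] TangentSpace (prodModel n) (e (φ t σ))
  gluing : ∀ t σ, ψ t σ ∈ (RplusTarget g g' F e (φ t σ)).baseChange Λ
  bosonDiff : ∀ σ, MDifferentiableAt 𝓘(ℝ, ℝ) (𝓡 k) (fun t => φ t σ) 0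
  fermionDiff : ∀ σ, ∀ c ∈ IsManifold.maximalAtlas (prodModel n) ∞ (X × X'),
    e (φ 0 σ) ∈ c.source → ∀ J, DifferentiableAt ℝ
      (fun t => fermionComponent (prodModel n) (prodBasis n) Λ c (e (φ t σ)) (ψ t σ) J) 0

namespace AllowedVariation

variable {g g' F e} {Λ : Type*} [NormedRing Λ] [NormedAlgebra ℝ Λ] {D : Type*}
  (V : AllowedVariation g g' F e Λ D)
  (c : OpenPartialHomeomorph (X × X') (ModelProd (EuclideanSpace ℝ (Fin n))
    (EuclideanSpace ℝ (Fin n))))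
  (σ : D)

/-- The coordinates of the point `φ(σ)` of `X × X'` in the chart `c`. -/
def coords : EuclideanSpace ℝ (Fin n) × EuclideanSpace ℝ (Fin n) :=
  c.extend (prodModel n) (e (V.φ 0 σ))

/-- The component `ψ^J` of the unvaried fermion at `σ`. -/
def psi (J : Fin n ⊕ Fin n) : Λ :=
  fermionComponent (prodModel n) (prodBasis n) Λ c (e (V.φ 0 σ)) (V.ψ 0 σ) J

/-- The bosonic variation `δφ^J` at `σ`. -/
def deltaPhi (J : Fin n ⊕ Fin n) : ℝ :=
  deriv (fun t => (prodBasis n).coord J (c.extend (prodModel n) (e (V.φ t σ)))) 0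

/-- The fermionic variation `δψ^J` at `σ`. -/
def deltaPsi (J : Fin n ⊕ Fin n) : Λ :=
  deriv (fun t => fermionComponent (prodModel n) (prodBasis n) Λ c (e (V.φ t σ)) (V.ψ t σ) J) 0

/-- The covariant variation `δ^cov ψ^J = δψ^J + δφ^K Γ^J_{KL} ψ^L` at `σ`. -/
def deltaCovPsi (J : Fin n ⊕ Fin n) : Λ :=
  V.deltaPsi c σ J + ∑ K, ∑ L,
    (V.deltaPhi c σ K *
      christoffel (prodModel n) (prodBasis n) (fun p u v => productMetric g g' p u v) c
        (V.coords c σ) J K L) • V.psi c σ L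

/-- The boundary term `G_{JK} ψ^J δ^cov ψ^K` at the point `σ` of the defect line. -/
def boundaryTerm : Λ :=
  ∑ J, ∑ K,
    coordMatrix (prodModel n) (prodBasis n) (fun p u v => productMetric g g' p u v) c
      (V.coords c σ) J K • (V.psi c σ J * V.deltaCovPsi c σ K)

end AllowedVariation

end Product

end Bibrane

end

/-! Fix charts of `Y` and `X × X'`. Let `f` be the expression of `e` in them, and put `h = f^*G`, `B
= h - F`. Then `R₊` is the left kernel of `B`, and the fermion is `ψ^J = ∂_i f^J χ^i` with `χ` in `Λ
⊗ R₊`. Write `w` for the velocity of `φ_t` and `χ'` for the derivative of `χ` at `t = 0`; `χ'`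
exists because `df` is injective (`differentiableAt_coeff`).

The second derivatives of `f` and the Christoffel symbols of `G` combine into the Koszul expression
of `h` (`koszul_pullbackForm`, `lower_christoffel`), so that twice the boundary term is `(∂_w h_{ij}
+ ∂_i h_{wj} - ∂_j h_{wi}) χ^j χ^i + 2 h_{ji} χ^j χ'^i`.

The gluing condition is `B_{ij} χ^i = 0`. Multiplied by `χ'` on the right it gives `B_{ji} χ^j χ'^i
= 0`. Its derivative, multiplied by `χ` on the left, gives `∂_w B_{ij} χ^j χ^i + B_{ij} χ^j χ'^i =
0`. Since `2 h_{ji} = B_{ji} + B_{ij}`, the term in `χ'` equals `-∂_w B_{ij} χ^j χ^i`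
(`contract_covariant_eq_zero`).

By `dF = 0`, what is left is `(∂_i B_{jw} - ∂_j B_{iw}) χ^j χ^i`. It vanishes because on an
integrable left kernel `(∂_u B)(v, w)` is symmetric in `u, v ∈ R₊` (`fderiv_symm_of_mem_ker`). These
steps are assembled in `contract_deltaCov_eq_zero`. Two factors in `Λ` are never interchanged, so no
commutation rule for the fermions is needed. -/

noncomputable section

namespace Bibrane

/-! ### Charts and their inverses: mutually inverse differentials. -/

section Charts

variable {E : Type*} [NormedAddCommGroup E] [NormedSpace ℝ E]
  {H : Type*} [TopologicalSpace H] {I : ModelWithCorners ℝ E H} [I.Boundaryless]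
  {M : Type*} [TopologicalSpace M] [ChartedSpace H M]
  {c : OpenPartialHomeomorph M H}

theorem contMDiffAt_extend_symm (hc : c ∈ IsManifold.maximalAtlas I ∞ M) {x : E}
    (hx : x ∈ (c.extend I).target) : ContMDiffAt 𝓘(ℝ, E) I ∞ (c.extend I).symm x := by
  refine (contMDiffOn_extend_symm hc).contMDiffAt ?_
  have h : I '' c.target = (c.extend I).target := by
    rw [c.extend_target_eq_image_source, ← c.image_source_eq_target, Set.image_image]
    rfl
  rw [h]
  exact c.isOpen_extend_target.mem_nhds hx

theorem coordVec_mfderiv_extend (hc : c ∈ IsManifold.maximalAtlas I ∞ M) {x : E}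
    (hx : x ∈ (c.extend I).target) (v : TangentSpace I ((c.extend I).symm x)) :
    coordVec I c x (mfderiv I 𝓘(ℝ, E) (c.extend I) ((c.extend I).symm x) v) = v := by
  have hp : (c.extend I).symm x ∈ c.source := by
    simpa [c.extend_source] using (c.extend I).map_target hx
  have h1 : MDifferentiableAt I 𝓘(ℝ, E) (c.extend I) ((c.extend I).symm x) :=
    (c.contMDiffAt_extend hc hp).mdifferentiableAt (by simp)
  have hr := (c.extend I).right_inv hx
  have h2 : MDifferentiableAt 𝓘(ℝ, E) I (c.extend I).symm (c.extend I ((c.extend I).symm x)) := by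
    rw [hr]
    exact (contMDiffAt_extend_symm hc hx).mdifferentiableAt (by simp)
  have h3 := mfderiv_comp _ h2 h1
  have h4 : (c.extend I).symm ∘ c.extend I =ᶠ[𝓝 ((c.extend I).symm x)] id := by
    filter_upwards [c.open_source.mem_nhds hp] with q hq
    exact c.extend_left_inv hq
  rw [h4.mfderiv_eq, mfderiv_id] at h3
  have h5 := congrArg (fun l => l v) h3
  rw [hr] at h5
  exact h5.symm

theorem mfderiv_extend_coordVec (hc : c ∈ IsManifold.maximalAtlas I ∞ M) {x : E}
    (hx : x ∈ (c.extend I).target) (a : E) :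
    mfderiv I 𝓘(ℝ, E) (c.extend I) ((c.extend I).symm x) (coordVec I c x a) = a := by
  have hp : (c.extend I).symm x ∈ c.source := by
    simpa [c.extend_source] using (c.extend I).map_target hx
  have h1 : MDifferentiableAt I 𝓘(ℝ, E) (c.extend I) ((c.extend I).symm x) :=
    (c.contMDiffAt_extend hc hp).mdifferentiableAt (by simp)
  have h2 : MDifferentiableAt 𝓘(ℝ, E) I (c.extend I).symm x :=
    (contMDiffAt_extend_symm hc hx).mdifferentiableAt (by simp)
  have h3 := mfderiv_comp _ h1 h2
  have h4 : c.extend I ∘ (c.extend I).symm =ᶠ[𝓝 x] id := by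
    filter_upwards [c.isOpen_extend_target.mem_nhds hx] with q hq
    exact (c.extend I).right_inv hq
  rw [h4.mfderiv_eq, mfderiv_id] at h3
  exact (congrArg (fun l => l a) h3).symm

omit [I.Boundaryless] [ChartedSpace H M] in
theorem exists_extend_symm_eq {p : M} (hp : p ∈ c.source) :
    ∃ x ∈ (c.extend I).target, (c.extend I).symm x = p := by
  refine ⟨c.extend I p, (c.extend I).map_source (by simpa [c.extend_source] using hp), ?_⟩
  exact c.extend_left_inv hp

/-- The base point and the components enter through equations, so that `p` can be replaced by
`(c.extend I).symm x` without transporting vectors between tangent spaces. -/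
theorem coordForm_extend (B : ∀ p : M, TangentSpace I p → TangentSpace I p → ℝ)
    (hc : c ∈ IsManifold.maximalAtlas I ∞ M) {p : M} (hp : p ∈ c.source)
    (v w : TangentSpace I p) {x a b : E} (hx : x = c.extend I p)
    (ha : a = mfderiv I 𝓘(ℝ, E) (c.extend I) p v)
    (hb : b = mfderiv I 𝓘(ℝ, E) (c.extend I) p w) :
    coordForm I B c x a b = B p v w := by
  obtain ⟨y, hy, rfl⟩ := exists_extend_symm_eq (I := I) hp
  rw [(c.extend I).right_inv hy] at hx
  subst hx ha hb
  change B _ (coordVec I c x _) (coordVec I c x _) = _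
  rw [coordVec_mfderiv_extend hc hy, coordVec_mfderiv_extend hc hy]

theorem mfderiv_extend_injective (hc : c ∈ IsManifold.maximalAtlas I ∞ M) {p : M}
    (hp : p ∈ c.source) : Function.Injective (mfderiv I 𝓘(ℝ, E) (c.extend I) p) := by
  obtain ⟨y, hy, rfl⟩ := exists_extend_symm_eq (I := I) hp
  exact Function.LeftInverse.injective (coordVec_mfderiv_extend hc hy)

theorem mfderiv_extend_surjective (hc : c ∈ IsManifold.maximalAtlas I ∞ M) {p : M}
    (hp : p ∈ c.source) : Function.Surjective (mfderiv I 𝓘(ℝ, E) (c.extend I) p) := by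
  obtain ⟨y, hy, rfl⟩ := exists_extend_symm_eq (I := I) hp
  exact fun a => ⟨_, mfderiv_extend_coordVec hc hy a⟩

end Charts

/-! ### Differentiability of the components of smooth bilinear forms. -/

section Smoothness

variable {E : Type*} [NormedAddCommGroup E] [NormedSpace ℝ E]
  {H : Type*} [TopologicalSpace H] {I : ModelWithCorners ℝ E H}
  {M : Type*} [TopologicalSpace M] [ChartedSpace H M] [IsManifold I ∞ M]
  {E' : Type*} [NormedAddCommGroup E'] [NormedSpace ℝ E']

/-- This is the tangent map of `s` composed with the constant vector field `a` on the model space.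
-/
theorem contMDiffAt_mfderiv_apply {s : E' → M} {U : Set E'} (hU : IsOpen U)
    (hs : ContMDiffOn 𝓘(ℝ, E') I ∞ s U) {x : E'} (hx : x ∈ U) (a : E') :
    ContMDiffAt 𝓘(ℝ, E') (I.prod 𝓘(ℝ, E)) ∞
      (fun z => Bundle.TotalSpace.mk' E (E := fun p : M => TangentSpace I p) (s z)
        (mfderiv 𝓘(ℝ, E') I s z a)) x := by
  have h1 := hs.contMDiffOn_tangentMapWithin (m := ∞) (by simp) hU.uniqueMDiffOn
  have h2 : ContMDiff 𝓘(ℝ, E') (𝓘(ℝ, E').prod 𝓘(ℝ, E')) ∞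
      (fun z : E' => (⟨z, a⟩ : TangentBundle 𝓘(ℝ, E') E')) := by
    exact contMDiff_vectorSpace_iff_contDiff.2 contDiff_const
  have h3 := (h1.comp (t := Bundle.TotalSpace.proj ⁻¹' U) (s := U) h2.contMDiffOn
    (fun z hz => hz)).contMDiffAt (hU.mem_nhds hx)
  refine h3.congr_of_eventuallyEq ?_
  filter_upwards [hU.mem_nhds hx] with z hz
  simp only [Function.comp, tangentMapWithin]
  rw [mfderivWithin_of_isOpen hU hz]

/-- A general map `s` is allowed, not only an inverse chart: for the product metric, `s` will be an
inverse chart followed by a projection to one factor. -/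
theorem differentiableAt_form_mfderiv
    {B : ∀ p : M, TangentSpace I p →L[ℝ] TangentSpace I p →L[ℝ] ℝ}
    (hB : ContMDiff I (I.prod 𝓘(ℝ, E →L[ℝ] E →L[ℝ] ℝ)) ∞
      (fun p => Bundle.TotalSpace.mk' (E →L[ℝ] E →L[ℝ] ℝ)
        (E := fun p : M => TangentSpace I p →L[ℝ] TangentSpace I p →L[ℝ] ℝ) p (B p)))
    {s : E' → M} {U : Set E'} (hU : IsOpen U)
    (hs : ContMDiffOn 𝓘(ℝ, E') I ∞ s U) {x : E'} (hx : x ∈ U) (a b : E') :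
    DifferentiableAt ℝ (fun z => B (s z) (mfderiv 𝓘(ℝ, E') I s z a)
      (mfderiv 𝓘(ℝ, E') I s z b)) x := by
  have h : ContMDiffAt 𝓘(ℝ, E') (I.prod 𝓘(ℝ, ℝ)) ∞
      (fun z => Bundle.TotalSpace.mk' ℝ (E := Bundle.Trivial M ℝ) (s z)
        (B (s z) (mfderiv 𝓘(ℝ, E') I s z a) (mfderiv 𝓘(ℝ, E') I s z b))) x := by
    apply ContMDiffAt.clm_bundle_apply₂ (F₁ := E) (F₂ := E)
      (E₁ := fun p : M => TangentSpace I p) (E₂ := fun p : M => TangentSpace I p)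
    · exact ContMDiffAt.comp x hB.contMDiffAt (hs.contMDiffAt (hU.mem_nhds hx))
    · exact contMDiffAt_mfderiv_apply hU hs hx a
    · exact contMDiffAt_mfderiv_apply hU hs hx b
  simp only [Bundle.contMDiffAt_totalSpace] at h
  exact (h.2.contDiffAt).differentiableAt (by simp)

theorem differentiableAt_coordForm [I.Boundaryless]
    {B : ∀ p : M, TangentSpace I p →L[ℝ] TangentSpace I p →L[ℝ] ℝ}
    (hB : ContMDiff I (I.prod 𝓘(ℝ, E →L[ℝ] E →L[ℝ] ℝ)) ∞
      (fun p => Bundle.TotalSpace.mk' (E →L[ℝ] E →L[ℝ] ℝ)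
        (E := fun p : M => TangentSpace I p →L[ℝ] TangentSpace I p →L[ℝ] ℝ) p (B p)))
    {c : OpenPartialHomeomorph M H} (hc : c ∈ IsManifold.maximalAtlas I ∞ M)
    {x : E} (hx : x ∈ (c.extend I).target) (a b : E) :
    DifferentiableAt ℝ (fun z => coordForm I (fun p u v => B p u v) c z a b) x :=
  differentiableAt_form_mfderiv hB c.isOpen_extend_target
    (fun _ hz => (contMDiffAt_extend_symm hc hz).contMDiffWithinAt) hx a b

end Smoothness

/-! ### Immersions have injective differentials. -/

section Immersion

variable {E : Type*} [NormedAddCommGroup E] [NormedSpace ℝ E]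
  {H : Type*} [TopologicalSpace H] {I : ModelWithCorners ℝ E H} [I.Boundaryless]
  {M : Type*} [TopologicalSpace M] [ChartedSpace H M]
  {E' : Type*} [NormedAddCommGroup E'] [NormedSpace ℝ E']
  {H' : Type*} [TopologicalSpace H'] {J : ModelWithCorners ℝ E' H'}
  {N : Type*} [TopologicalSpace N] [ChartedSpace H' N]

/-- In adapted charts an immersion is the linear injection `l`, namely `x ↦ (x, 0)` followed by a
linear equivalence; the chain rule carries injectivity back to the manifolds. -/
theorem mfderiv_injective_of_isImmersionAt {f : M → N} {p : M}
    [IsManifold I ∞ M] [IsManifold J ∞ N]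
    (hf : Manifold.IsImmersionAt I J ∞ f p) : Function.Injective (mfderiv I J f p) := by
  set d := hf.domChart with hd
  have hdp : p ∈ d.source := hf.mem_domChart_source
  have hdm : d ∈ IsManifold.maximalAtlas I ∞ M := hf.domChart_mem_maximalAtlas
  have h1 : MDifferentiableAt J 𝓘(ℝ, E') (hf.codChart.extend J) (f p) :=
    (hf.codChart.contMDiffAt_extend hf.codChart_mem_maximalAtlas
      hf.mem_codChart_source).mdifferentiableAt (by simp)
  have h2 : MDifferentiableAt I J f p := hf.contMDiffAt.mdifferentiableAt (by simp)
  have h3 : MDifferentiableAt I 𝓘(ℝ, E) (d.extend I) p :=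
    (d.contMDiffAt_extend hdm hdp).mdifferentiableAt (by simp)
  let l : E →L[ℝ] E' := hf.equiv.toContinuousLinearMap.comp (ContinuousLinearMap.inl ℝ E _)
  have hl : Function.Injective l :=
    hf.equiv.injective.comp (fun a b h => (Prod.ext_iff.1 h).1)
  have h4 : hf.codChart.extend J ∘ f =ᶠ[𝓝 p] l ∘ d.extend I := by
    filter_upwards [d.open_source.mem_nhds hdp] with q hq
    have h5 := hf.writtenInCharts
      ((d.extend I).map_source (by simpa [d.extend_source] using hq))
    simp only [Function.comp] at h5 ⊢
    rw [← hd, d.extend_left_inv hq] at h5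
    exact h5
  have h6 := h4.mfderiv_eq (I := I) (I' := 𝓘(ℝ, E'))
  rw [mfderiv_comp p h1 h2, mfderiv_comp p l.mdifferentiableAt h3] at h6
  have h7 : Function.Injective (mfderiv 𝓘(ℝ, E) 𝓘(ℝ, E') l (d.extend I p)) := by
    rw [mfderiv_eq_fderiv, l.fderiv]
    exact hl
  have h8 := h7.comp (mfderiv_extend_injective hdm hdp)
  intro u v huv
  apply h8
  have hu := congrArg (fun L => L u) h6
  have hv := congrArg (fun L => L v) h6
  exact hu.symm.trans ((congrArg (mfderiv J 𝓘(ℝ, E') (hf.codChart.extend J) (f p)) huv).trans hv)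

end Immersion

end Bibrane
end

noncomputable section

namespace Bibrane

/-! ### Derivatives of pulled-back bilinear forms and of their kernels. -/

section Pullback

variable {E : Type*} [NormedAddCommGroup E] [NormedSpace ℝ E]
  {W : Type*} [NormedAddCommGroup W] [NormedSpace ℝ W]

/-- The pullback along `f` of a field `G` of bilinear forms. -/
def pullbackForm (G : W → W →L[ℝ] W →L[ℝ] ℝ) (f : E → W) (y : E) : E →L[ℝ] E →L[ℝ] ℝ :=
  (G (f y)).bilinearComp (fderiv ℝ f y) (fderiv ℝ f y)

@[simp]
theorem pullbackForm_apply (G : W → W →L[ℝ] W →L[ℝ] ℝ) (f : E → W) (y a b : E) :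
    pullbackForm G f y a b = G (f y) (fderiv ℝ f y a) (fderiv ℝ f y b) := rfl

theorem differentiableAt_flip {E' : Type*} [NormedAddCommGroup E'] [NormedSpace ℝ E']
    {h : E → E' →L[ℝ] W →L[ℝ] ℝ} {y : E} (hh : DifferentiableAt ℝ h y) :
    DifferentiableAt ℝ (fun z => (h z).flip) y := by
  have h1 := LinearIsometryEquiv.differentiable (𝕜 := ℝ) (E := E' →L[ℝ] W →L[ℝ] ℝ)
    (F := W →L[ℝ] E' →L[ℝ] ℝ) (ContinuousLinearMap.flipₗᵢ ℝ E' W ℝ)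
  exact DifferentiableAt.comp (g := ContinuousLinearMap.flipₗᵢ ℝ E' W ℝ) y h1.differentiableAt hh

variable {G : W → W →L[ℝ] W →L[ℝ] ℝ} {f : E → W} {y : E}

theorem differentiableAt_pullbackForm (hG : DifferentiableAt ℝ G (f y))
    (hf : ContDiffAt ℝ 2 f y) : DifferentiableAt ℝ (pullbackForm G f) y := by
  have h1 : DifferentiableAt ℝ f y := hf.differentiableAt (by simp)
  have h2 : DifferentiableAt ℝ (fderiv ℝ f) y :=
    (hf.fderiv_right (m := 1) (by norm_num)).differentiableAt (by simp)
  -- Pulling back in both arguments is composing, flipping, composing and flipping back, so the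
  -- product rule for compositions suffices.
  have h3 : DifferentiableAt ℝ (fun z => (G (f z)).comp (fderiv ℝ f z)) y :=
    (hG.comp y h1).clm_comp h2
  have h4 : DifferentiableAt ℝ (fun z => ((G (f z)).comp (fderiv ℝ f z)).flip) y :=
    differentiableAt_flip h3
  exact differentiableAt_flip (h4.clm_comp h2)

theorem fderiv_pullbackForm_apply (hG : DifferentiableAt ℝ G (f y))
    (hf : ContDiffAt ℝ 2 f y) (w a b : E) :
    fderiv ℝ (pullbackForm G f) y w a b =
      fderiv ℝ G (f y) (fderiv ℝ f y w) (fderiv ℝ f y a) (fderiv ℝ f y b)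
      + G (f y) (fderiv ℝ (fderiv ℝ f) y w a) (fderiv ℝ f y b)
      + G (f y) (fderiv ℝ f y a) (fderiv ℝ (fderiv ℝ f) y w b) := by
  have h1 : HasFDerivAt f (fderiv ℝ f y) y := (hf.differentiableAt (by simp)).hasFDerivAt
  have h2 : HasFDerivAt (fderiv ℝ f) (fderiv ℝ (fderiv ℝ f) y) y :=
    ((hf.fderiv_right (m := 1) (by norm_num)).differentiableAt (by simp)).hasFDerivAt
  have h3 (v : E) : HasFDerivAt (fun z => fderiv ℝ f z v) _ y :=
    h2.clm_apply (hasFDerivAt_const v y)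
  have h7 : HasFDerivAt (fun z => G (f z)) ((fderiv ℝ G (f y)).comp (fderiv ℝ f y)) y :=
    HasFDerivAt.comp (g := G) y hG.hasFDerivAt h1
  have h4 := (h7.clm_apply (h3 a)).clm_apply (h3 b)
  have h5 := (((differentiableAt_pullbackForm hG hf).hasFDerivAt.clm_apply
    (hasFDerivAt_const a y)).clm_apply (hasFDerivAt_const b y))
  have h6 := congrArg (fun l => l w) (h5.unique h4)
  simp at h6
  rw [h6]
  ring

/-- Six terms contain the second derivative of `f`. By its symmetry and that of `G`, four cancel in
pairs and two coincide. The remainder is the lowered Christoffel symbol of `G`, so the right side is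
`2 G(∂_b f, ∇_w ∂_a f)`. -/
theorem koszul_pullbackForm (hG : DifferentiableAt ℝ G (f y)) (hf : ContDiffAt ℝ 2 f y)
    (hs : ∀ x a b, G x a b = G x b a) (w a b : E) :
    fderiv ℝ (pullbackForm G f) y w a b + fderiv ℝ (pullbackForm G f) y a w b
      - fderiv ℝ (pullbackForm G f) y b w a =
    2 * G (f y) (fderiv ℝ f y b) (fderiv ℝ (fderiv ℝ f) y w a)
    + (fderiv ℝ G (f y) (fderiv ℝ f y w) (fderiv ℝ f y a) (fderiv ℝ f y b)
      + fderiv ℝ G (f y) (fderiv ℝ f y a) (fderiv ℝ f y w) (fderiv ℝ f y b)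
      - fderiv ℝ G (f y) (fderiv ℝ f y b) (fderiv ℝ f y w) (fderiv ℝ f y a)) := by
  have h := hf.isSymmSndFDerivAt (by simp)
  simp only [fderiv_pullbackForm_apply hG hf]
  rw [h.eq a w, h.eq b w, h.eq b a, hs _ (fderiv ℝ (fderiv ℝ f) y w a),
    hs _ (fderiv ℝ (fderiv ℝ f) y w b) (fderiv ℝ f y a)]
  ring

/-- If the tangent spaces of a submanifold, parametrized by `j`, lie in the left kernels of `B`,
then the derivative of `B` is symmetric in two directions tangent to the submanifold. -/
theorem fderiv_symm_of_mem_ker {B : E → E →L[ℝ] E →L[ℝ] ℝ} {j : W → E} {x : W}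
    (hB : DifferentiableAt ℝ B (j x)) (hj : ContDiffAt ℝ 2 j x)
    (hker : ∀ᶠ z in 𝓝 x, ∀ a w, B (j z) (fderiv ℝ j z a) w = 0) (a b : W) (w : E) :
    fderiv ℝ B (j x) (fderiv ℝ j x a) (fderiv ℝ j x b) w
      = fderiv ℝ B (j x) (fderiv ℝ j x b) (fderiv ℝ j x a) w := by
  have h1 : HasFDerivAt j (fderiv ℝ j x) x := (hj.differentiableAt (by simp)).hasFDerivAt
  have h2 : HasFDerivAt (fderiv ℝ j) (fderiv ℝ (fderiv ℝ j) x) x :=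
    ((hj.fderiv_right (m := 1) (by norm_num)).differentiableAt (by simp)).hasFDerivAt
  have key (a b : W) : fderiv ℝ B (j x) (fderiv ℝ j x a) (fderiv ℝ j x b) w
      -- Differentiating `B(∂_b j, w) = 0` in the direction `a` trades the derivative of `B` for the
      -- second derivative of `j`, which is symmetric.
      = - B (j x) (fderiv ℝ (fderiv ℝ j) x a b) w := by
    have h7 : HasFDerivAt (fun z => B (j z)) ((fderiv ℝ B (j x)).comp (fderiv ℝ j x)) x :=
      HasFDerivAt.comp (g := B) x hB.hasFDerivAt h1
    have h4 := (h7.clm_apply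
      (h2.clm_apply (hasFDerivAt_const b x))).clm_apply (hasFDerivAt_const w x)
    have h5 : HasFDerivAt (fun z => B (j z) (fderiv ℝ j z b) w) (0 : W →L[ℝ] ℝ) x :=
      (hasFDerivAt_const (0 : ℝ) x).congr_of_eventuallyEq (hker.mono fun z hz => hz b w)
    have h6 := congrArg (fun l => l a) (h4.unique h5)
    simp at h6
    linarith
  rw [key, key, (hj.isSymmSndFDerivAt (by simp)).eq a b]

end Pullback

/-! ### Vectors with coefficients in `Λ` and their contractions. -/

section Coefficients

variable {Λ : Type*} [NormedRing Λ] [NormedAlgebra ℝ Λ]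
  {V V' : Type*} [AddCommGroup V] [Module ℝ V] [AddCommGroup V'] [Module ℝ V']
  {ι κ : Type*} [Fintype ι] [Fintype κ]

/-- The `Λ`-valued component of a vector with coefficients in `Λ` along a linear functional. -/
def coeff (ℓ : V →ₗ[ℝ] ℝ) (Θ : Λ ⊗[ℝ] V) : Λ :=
  TensorProduct.rid ℝ Λ (LinearMap.lTensor Λ ℓ Θ)

@[simp]
theorem coeff_tmul (ℓ : V →ₗ[ℝ] ℝ) (a : Λ) (v : V) : coeff ℓ (a ⊗ₜ[ℝ] v) = ℓ v • a := by
  simp [coeff]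

@[simp]
theorem coeff_zero (ℓ : V →ₗ[ℝ] ℝ) : coeff ℓ (0 : Λ ⊗[ℝ] V) = 0 := by
  simp [coeff]

@[simp]
theorem coeff_add (ℓ : V →ₗ[ℝ] ℝ) (Θ Θ' : Λ ⊗[ℝ] V) :
    coeff ℓ (Θ + Θ') = coeff ℓ Θ + coeff ℓ Θ' := by
  simp [coeff]

theorem coeff_lTensor (ℓ : V' →ₗ[ℝ] ℝ) (l : V →ₗ[ℝ] V') (Θ : Λ ⊗[ℝ] V) :
    coeff ℓ (LinearMap.lTensor Λ l Θ) = coeff (ℓ ∘ₗ l) Θ := by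
  simp [coeff, LinearMap.lTensor_comp]

theorem coeff_eq_sum (e : Module.Basis ι ℝ V) (ℓ : V →ₗ[ℝ] ℝ) (Θ : Λ ⊗[ℝ] V) :
    coeff ℓ Θ = ∑ i, ℓ (e i) • coeff (e.coord i) Θ := by
  induction Θ using TensorProduct.induction_on with
  | zero => simp
  | add x y hx hy => simp [hx, hy, Finset.sum_add_distrib]
  | tmul a v =>
    have h := congrArg ℓ (e.sum_repr v)
    rw [map_sum] at h
    simp only [coeff_tmul, smul_smul, ← Finset.sum_smul, ← h, map_smul, smul_eq_mul,
      Module.Basis.coord_apply, mul_comm]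

theorem coeff_sum_smul (r : ι → ℝ) (ℓ : ι → V →ₗ[ℝ] ℝ) (Θ : Λ ⊗[ℝ] V) :
    coeff (∑ i, r i • ℓ i) Θ = ∑ i, r i • coeff (ℓ i) Θ := by
  induction Θ using TensorProduct.induction_on with
  | zero => simp
  | add x y hx hy => simp [hx, hy, Finset.sum_add_distrib]
  | tmul a v => simp [Finset.sum_smul, smul_smul]

theorem baseChange_induction {K : Submodule ℝ V} {P : Λ ⊗[ℝ] V → Prop}
    (zero : P 0) (add : ∀ x y, P x → P y → P (x + y))
    (tmul : ∀ (a : Λ), ∀ v ∈ K, P (a ⊗ₜ v)) {Θ : Λ ⊗[ℝ] V} (hΘ : Θ ∈ K.baseChange Λ) : P Θ := by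
  obtain ⟨Θ', rfl⟩ : Θ ∈ LinearMap.range (LinearMap.lTensor Λ K.subtype) := hΘ
  induction Θ' using TensorProduct.induction_on with
  | zero => simpa using zero
  | add x y hx hy =>
    rw [map_add]
    exact add _ _ hx hy
  | tmul a v => exact tmul a v v.2

theorem exists_of_mem_baseChange_map {K : Submodule ℝ V} (l : V →ₗ[ℝ] V') {Θ : Λ ⊗[ℝ] V'}
    (hΘ : Θ ∈ (K.map l).baseChange Λ) :
    ∃ Θ' ∈ K.baseChange Λ, LinearMap.lTensor Λ l Θ' = Θ := by
  refine baseChange_induction (P := fun Θ => ∃ Θ' ∈ K.baseChange Λ,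
    LinearMap.lTensor Λ l Θ' = Θ) ⟨0, zero_mem _, by simp⟩ ?_ ?_ hΘ
  · rintro _ _ ⟨x, hx, rfl⟩ ⟨y, hy, rfl⟩
    exact ⟨x + y, add_mem hx hy, map_add _ _ _⟩
  · rintro a _ ⟨v, hv, rfl⟩
    exact ⟨a ⊗ₜ v, Submodule.tmul_mem_baseChange_of_mem a hv, by simp⟩

theorem coeff_eq_zero {K : Submodule ℝ V} {ℓ : V →ₗ[ℝ] ℝ} (hℓ : ∀ v ∈ K, ℓ v = 0)
    {Θ : Λ ⊗[ℝ] V} (hΘ : Θ ∈ K.baseChange Λ) : coeff ℓ Θ = 0 := by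
  refine baseChange_induction (P := fun Θ => coeff ℓ Θ = 0) (by simp) ?_ ?_ hΘ
  · intro x y hx hy
    simp [hx, hy]
  · intro a v hv
    simp [hℓ v hv]

/-- The contraction `X_{JK} χ^J ξ^K`. -/
def contract (X : ι → κ → ℝ) (χ : ι → Λ) (ξ : κ → Λ) : Λ :=
  ∑ j, ∑ i, X j i • (χ j * ξ i)

theorem contract_add_right (X : ι → κ → ℝ) (χ : ι → Λ) (ξ ξ' : κ → Λ) :
    contract X χ (ξ + ξ') = contract X χ ξ + contract X χ ξ' := by
  simp [contract, mul_add, Finset.sum_add_distrib]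

theorem contract_add_form (X X' : ι → κ → ℝ) (χ : ι → Λ) (ξ : κ → Λ) :
    contract (X + X') χ ξ = contract X χ ξ + contract X' χ ξ := by
  simp [contract, add_smul, Finset.sum_add_distrib]

theorem contract_smul_form (r : ℝ) (X : ι → κ → ℝ) (χ : ι → Λ) (ξ : κ → Λ) :
    contract (r • X) χ ξ = r • contract X χ ξ := by
  simp [contract, Finset.smul_sum, smul_smul]

theorem contract_eq_sum_right (X : ι → κ → ℝ) (χ : ι → Λ) (ξ : κ → Λ) :
    contract X χ ξ = ∑ i, (∑ j, X j i • χ j) * ξ i := by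
  rw [contract, Finset.sum_comm]
  simp [Finset.sum_mul]

theorem contract_eq_sum_left (X : ι → κ → ℝ) (χ : ι → Λ) (ξ : κ → Λ) :
    contract X χ ξ = ∑ j, χ j * ∑ i, X j i • ξ i := by
  simp [contract, Finset.mul_sum]

/-- For a pure tensor `a ⊗ v` in the left slot the contraction is `a` times the component of `Θ'`
along `T v`, and `T v` kills `K`. The order of the factors is kept throughout. -/
theorem contract_eq_zero {K : Submodule ℝ V} (e : Module.Basis ι ℝ V)
    {T : V →ₗ[ℝ] V →ₗ[ℝ] ℝ} (hT : ∀ u ∈ K, ∀ v ∈ K, T u v = 0)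
    {Θ Θ' : Λ ⊗[ℝ] V} (hΘ : Θ ∈ K.baseChange Λ) (hΘ' : Θ' ∈ K.baseChange Λ) :
    contract (fun j i => T (e j) (e i)) (fun j => coeff (e.coord j) Θ)
      (fun i => coeff (e.coord i) Θ') = 0 := by
  simp only [contract_eq_sum_left, ← coeff_eq_sum e]
  refine baseChange_induction (P := fun Θ => ∑ j, coeff (e.coord j) Θ * coeff (T (e j)) Θ' = 0)
    (by simp) ?_ ?_ hΘ
  · intro x y hx hy
    simp [add_mul, Finset.sum_add_distrib, hx, hy]
  · intro a v hv
    have h : ∑ j, e.coord j v • coeff (T (e j)) Θ' = coeff (T v) Θ' := by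
      have hv' := congrArg T (e.sum_repr v)
      simp only [map_sum, map_smul] at hv'
      rw [← hv', coeff_sum_smul]
      rfl
    have h' := congrArg (fun x => a * x) (h.trans (coeff_eq_zero (hT v hv) hΘ'))
    simpa [Finset.mul_sum] using h'

theorem contract_sum_left {α : Type*} [Fintype α] (X : ι → κ → ℝ) (U : ι → α → ℝ) (χ : α → Λ)
    (ξ : κ → Λ) : contract X (fun J => ∑ i, U J i • χ i) ξ
      = contract (fun i K => ∑ J, U J i * X J K) χ ξ := by
  simp only [contract, Finset.sum_mul, Finset.smul_sum, Finset.sum_smul]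
  calc _ = ∑ K, ∑ J, ∑ i, X J K • (U J i • χ i * ξ K) := Finset.sum_comm
    _ = ∑ K, ∑ i, ∑ J, X J K • (U J i • χ i * ξ K) := by
      refine Finset.sum_congr rfl fun K _ => Finset.sum_comm
    _ = ∑ i, ∑ K, ∑ J, X J K • (U J i • χ i * ξ K) := Finset.sum_comm
    _ = _ := by simp [smul_smul, mul_comm]

theorem contract_sum_right {α : Type*} [Fintype α] (X : ι → κ → ℝ) (U : κ → α → ℝ) (χ : ι → Λ)
    (ξ : α → Λ) : contract X χ (fun K => ∑ i, U K i • ξ i)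
      = contract (fun J i => ∑ K, U K i * X J K) χ ξ := by
  simp only [contract, Finset.mul_sum, Finset.smul_sum, Finset.sum_smul]
  refine Finset.sum_congr rfl fun J _ => Finset.sum_comm.trans ?_
  simp [smul_smul, mul_comm]

theorem contract_basis {W : Type*} [NormedAddCommGroup W] [NormedSpace ℝ W]
    {α : Type*} [Fintype α] {α' : Type*} [Fintype α']
    (β : Module.Basis κ ℝ W) (X : W →L[ℝ] W →L[ℝ] ℝ) (u : α → W) (v : α' → W)
    (χ : α → Λ) (χ' : α' → Λ) :
    contract (fun J K => X (β J) (β K)) (fun J => ∑ i, β.coord J (u i) • χ i)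
      (fun J => ∑ i, β.coord J (v i) • χ' i) = contract (fun i j => X (u i) (v j)) χ χ' := by
  rw [contract_sum_right, contract_sum_left]
  congr 1
  ext i j
  have h1 := congrArg X (β.sum_repr (u i))
  have h2 := congrArg (X (u i)) (β.sum_repr (v j))
  rw [← h2, ← h1]
  simp only [map_sum, map_smul, Module.Basis.coord_apply, smul_eq_mul,
    sum_apply, smul_apply, Finset.mul_sum]
  rw [Finset.sum_comm]
  refine Finset.sum_congr rfl fun K _ => Finset.sum_congr rfl fun J _ => ?_
  ring

/-- The algebraic core. Here `h1` is the gluing condition and `h2` its derivative, with `D` the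
derivative of `h - F` along the variation. `Dh` is the Koszul expression of `h`, and `C` is its
excess over `D`. -/
theorem contract_covariant_eq_zero {ι : Type*} [Fintype ι]
    {h F D : ι → ι → ℝ} {Dh C : ι → ι → ℝ}
    {χ χ' : ι → Λ} (hh : ∀ i j, h i j = h j i) (hF : ∀ i j, F i j = - F j i)
    (h1 : ∀ j, ∑ i, (h i j - F i j) • χ i = 0)
    (h2 : ∀ j, ∑ i, (D i j • χ i + (h i j - F i j) • χ' i) = 0)
    (h3 : contract C χ χ = 0) (hC : ∀ i j, Dh j i = D i j + C j i) :
    contract Dh χ χ + (2 : ℝ) • contract h χ χ' = 0 := by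
  have e1 : contract (fun j i => h j i - F j i) χ χ' = 0 := by
    simp [contract_eq_sum_right, h1]
  have e2 : contract (fun j i => D i j) χ χ + contract (fun j i => h i j - F i j) χ χ' = 0 := by
    simp only [contract_eq_sum_left, ← Finset.sum_add_distrib, ← mul_add]
    simp [h2]
  have e3 : Dh = (fun j i => D i j) + C := by
    ext j i
    exact hC i j
  -- The antisymmetric `F` drops out of the sum of `h - F` and its transpose; `e1` and `e2` evaluate
  -- the two summands.
  have e4 : (2 : ℝ) • h = (fun j i => h j i - F j i) + (fun j i => h i j - F i j) := by
    ext j i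
    simp only [Pi.smul_apply, Pi.add_apply, smul_eq_mul]
    rw [hh i j, hF i j]
    ring
  rw [← contract_smul_form, e4, e3, contract_add_form, contract_add_form, h3, e1, add_zero,
    zero_add, e2]

end Coefficients

end Bibrane
end

noncomputable section

set_option maxSynthPendingDepth 3

namespace Bibrane

/-! ### The vanishing of the boundary term in coordinates. -/

section LocalTheorem

variable {Λ : Type*} [NormedRing Λ] [NormedAlgebra ℝ Λ]
  {E : Type*} [NormedAddCommGroup E] [NormedSpace ℝ E]
  {W : Type*} [NormedAddCommGroup W] [NormedSpace ℝ W]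
  {ι κ : Type*} [Fintype ι] [Fintype κ]

/-- With `L` a left inverse of `A t₀`, the endomorphism `P t = L ∘ A t` is the identity at `t₀`,
hence invertible nearby. There `Θ = P⁻¹ L (A Θ)` expresses the components of `Θ` through those of `A
Θ`. The spaces in which `Θ t` lies may vary with `t`, even in dimension. -/
theorem differentiableAt_coeff (e : Module.Basis ι ℝ E) (β : Module.Basis κ ℝ W)
    {A : ℝ → E →L[ℝ] W} {t₀ : ℝ} (hA : DifferentiableAt ℝ A t₀)
    (hinj : Function.Injective (A t₀)) {Θ : ℝ → Λ ⊗[ℝ] E}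
    (hψ : ∀ J, DifferentiableAt ℝ
      (fun t => coeff (β.coord J ∘ₗ (A t : E →ₗ[ℝ] W)) (Θ t)) t₀) (i : ι) :
    DifferentiableAt ℝ (fun t => coeff (e.coord i) (Θ t)) t₀ := by
  have : FiniteDimensional ℝ E := Module.Finite.of_basis e
  have : FiniteDimensional ℝ W := Module.Finite.of_basis β
  have : CompleteSpace E := FiniteDimensional.complete ℝ E
  obtain ⟨L, hL⟩ := LinearMap.exists_leftInverse_of_injective (A t₀ : E →ₗ[ℝ] W)
    (LinearMap.ker_eq_bot.2 hinj)
  let Lc : W →L[ℝ] E := LinearMap.toContinuousLinearMap L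
  let P : ℝ → E →L[ℝ] E := fun t => Lc.comp (A t)
  have hP : DifferentiableAt ℝ P t₀ := (differentiableAt_const Lc).clm_comp hA
  have hP0 : P t₀ = 1 := by
    ext v
    exact congrArg (fun l => l v) hL
  have hR : DifferentiableAt ℝ (fun t => Ring.inverse (P t)) t₀ := by
    have h : DifferentiableAt ℝ (Ring.inverse : (E →L[ℝ] E) → _) (P t₀) := by
      rw [hP0]
      exact differentiableAt_inverse (𝕜 := ℝ) isUnit_one
    exact DifferentiableAt.comp (g := Ring.inverse) t₀ h hP
  have hunit : ∀ᶠ t in 𝓝 t₀, IsUnit (P t) := by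
    refine hP.continuousAt.eventually (Units.isOpen.mem_nhds ?_)
    change IsUnit (P t₀)
    rw [hP0]
    exact isUnit_one
  have hq (j : ι) : DifferentiableAt ℝ
      (fun t => coeff (e.coord j ∘ₗ (P t : E →ₗ[ℝ] E)) (Θ t)) t₀ := by
    have h (t : ℝ) : coeff (e.coord j ∘ₗ (P t : E →ₗ[ℝ] E)) (Θ t)
        = ∑ J, e.coord j (L (β J)) • coeff (β.coord J ∘ₗ (A t : E →ₗ[ℝ] W)) (Θ t) := by
      rw [← coeff_sum_smul]
      congr 1
      ext v
      have h1 := congrArg (fun x => e.coord j (L x)) (β.sum_repr (A t v))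
      simp only [map_sum, map_smul] at h1
      simpa [P, Lc, mul_comm] using h1.symm
    simp only [h]
    exact DifferentiableAt.fun_sum fun J _ => (hψ J).fun_const_smul _
  have hr (j : ι) : DifferentiableAt ℝ (fun t => e.coord i (Ring.inverse (P t) (e j))) t₀ := by
    have h1 := hR.clm_apply (differentiableAt_const (e j))
    exact ((LinearMap.toContinuousLinearMap (e.coord i)).differentiableAt).comp t₀ h1
  have hs : DifferentiableAt ℝ (fun t => ∑ j, e.coord i (Ring.inverse (P t) (e j)) •
      coeff (e.coord j ∘ₗ (P t : E →ₗ[ℝ] E)) (Θ t)) t₀ :=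
    DifferentiableAt.fun_sum fun j _ => (hr j).smul (hq j)
  refine hs.congr_of_eventuallyEq ?_
  filter_upwards [hunit] with t ht
  rw [← coeff_sum_smul]
  congr 1
  ext v
  have h1 := congrArg (fun x => e.coord i (Ring.inverse (P t) x)) (e.sum_repr (P t v))
  have h2 : Ring.inverse (P t) (P t v) = v :=
    congrArg (fun l : E →L[ℝ] E => l v) (Ring.inverse_mul_cancel _ ht)
  simp only [map_sum, map_smul, h2] at h1
  simpa [mul_comm] using h1.symm

theorem trilinear_eq_sum (β : Module.Basis κ ℝ W) (D : W →L[ℝ] W →L[ℝ] W →L[ℝ] ℝ) (u v a : W) :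
    D u v a = ∑ J, ∑ L, ∑ N, β.coord J a * β.coord L u * β.coord N v * D (β L) (β N) (β J) := by
  have h1 := congrArg (D u v) (β.sum_repr a)
  have h2 := congrArg D (β.sum_repr u)
  have h3 (L) := congrArg (D (β L)) (β.sum_repr v)
  rw [← h1, ← h2]
  simp only [map_sum, map_smul, sum_apply, smul_apply, smul_eq_mul, ← h3, Finset.mul_sum,
    Module.Basis.coord_apply]
  refine Finset.sum_congr rfl fun J _ => Finset.sum_congr rfl fun L _ =>
    Finset.sum_congr rfl fun N _ => ?_
  ring

/-- Lowering the upper index of Christoffel symbols. -/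
theorem lower_christoffel (β : Module.Basis κ ℝ W) (G : W →L[ℝ] W →L[ℝ] ℝ)
    (D : W →L[ℝ] W →L[ℝ] W →L[ℝ] ℝ) (Γ : κ → κ → κ → ℝ)
    (hΓ : ∀ J L N, ∑ K, G (β J) (β K) * Γ K L N =
      (1 / 2 : ℝ) * (D (β L) (β N) (β J) + D (β N) (β L) (β J) - D (β J) (β L) (β N)))
    (u v a : W) :
    G a (∑ K, (∑ L, ∑ N, β.coord L u * Γ K L N * β.coord N v) • β K)
      = (1 / 2 : ℝ) * (D u v a + D v u a - D a u v) := by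
  have e1 : D v u a
      = ∑ J, ∑ L, ∑ N, β.coord J a * β.coord L u * β.coord N v * D (β N) (β L) (β J) := by
    rw [trilinear_eq_sum β]
    refine Finset.sum_congr rfl fun J _ => Finset.sum_comm.trans ?_
    refine Finset.sum_congr rfl fun L _ => Finset.sum_congr rfl fun N _ => ?_
    ring
  have e2 : D a u v
      = ∑ J, ∑ L, ∑ N, β.coord J a * β.coord L u * β.coord N v * D (β J) (β L) (β N) := by
    rw [trilinear_eq_sum β, Finset.sum_comm]
    refine Finset.sum_congr rfl fun J _ => Finset.sum_comm.trans ?_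
    refine Finset.sum_congr rfl fun L _ => Finset.sum_congr rfl fun N _ => ?_
    ring
  have e3 : G a (∑ K, (∑ L, ∑ N, β.coord L u * Γ K L N * β.coord N v) • β K)
      = ∑ J, ∑ L, ∑ N, β.coord J a * β.coord L u * β.coord N v *
        ∑ K, G (β J) (β K) * Γ K L N := by
    have h := congrArg G (β.sum_repr a)
    rw [← h]
    simp only [map_sum, map_smul, sum_apply, smul_apply, smul_eq_mul, Finset.mul_sum,
      Finset.sum_mul, Module.Basis.coord_apply]
    rw [Finset.sum_comm]
    refine Finset.sum_congr rfl fun J _ => ?_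
    refine Finset.sum_comm.trans (Finset.sum_congr rfl fun L _ => ?_)
    refine Finset.sum_comm.trans (Finset.sum_congr rfl fun N _ => ?_)
    refine Finset.sum_congr rfl fun K _ => ?_
    ring
  rw [e3, trilinear_eq_sum β D u v a, e1, e2]
  simp only [hΓ, ← Finset.sum_add_distrib, ← Finset.sum_sub_distrib, Finset.mul_sum]
  refine Finset.sum_congr rfl fun J _ => Finset.sum_congr rfl fun L _ =>
    Finset.sum_congr rfl fun N _ => ?_
  ring

/-- `f` stands for the embedding in charts, `γ` for the path of the boson, `K t` for `R₊` at `γ t`,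
and `Θ t` for the fermion as a vector tangent to `Y`. Integrability enters only through the symmetry
`hint`. -/
theorem contract_deltaCov_eq_zero (e : Module.Basis ι ℝ E) (β : Module.Basis κ ℝ W)
    {G : W → W →L[ℝ] W →L[ℝ] ℝ} {F : E → E →L[ℝ] E →L[ℝ] ℝ} {f : E → W} {γ : ℝ → E}
    (hG : DifferentiableAt ℝ G (f (γ 0))) (hF : DifferentiableAt ℝ F (γ 0))
    (hf : ContDiffAt ℝ 2 f (γ 0)) (hγ : DifferentiableAt ℝ γ 0)
    (hinj : Function.Injective (fderiv ℝ f (γ 0)))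
    (hGs : ∀ x a b, G x a b = G x b a) (hFa : ∀ y a b, F y a b = - F y b a)
    (hclosed : ∀ a b d, fderiv ℝ F (γ 0) a b d + fderiv ℝ F (γ 0) b d a
      + fderiv ℝ F (γ 0) d a b = 0)
    (K : ℝ → Submodule ℝ E)
    (hK : ∀ᶠ t in 𝓝 0, ∀ u ∈ K t, ∀ w, pullbackForm G f (γ t) u w = F (γ t) u w)
    (hint : ∀ u ∈ K 0, ∀ v ∈ K 0, ∀ w,
      fderiv ℝ (fun y => pullbackForm G f y - F y) (γ 0) u v w
        = fderiv ℝ (fun y => pullbackForm G f y - F y) (γ 0) v u w)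
    {Θ : ℝ → Λ ⊗[ℝ] E} (hΘ : ∀ᶠ t in 𝓝 0, Θ t ∈ (K t).baseChange Λ)
    {ψ : ℝ → κ → Λ} (hψ : ∀ J, DifferentiableAt ℝ (fun t => ψ t J) 0)
    (hψΘ : ∀ᶠ t in 𝓝 0, ∀ J,
      ψ t J = coeff (β.coord J ∘ₗ (fderiv ℝ f (γ t) : E →ₗ[ℝ] W)) (Θ t))
    {Γ : κ → κ → κ → ℝ}
    (hΓ : ∀ J L N, ∑ K, G (f (γ 0)) (β J) (β K) * Γ K L N =
      (1 / 2 : ℝ) * (fderiv ℝ G (f (γ 0)) (β L) (β N) (β J)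
        + fderiv ℝ G (f (γ 0)) (β N) (β L) (β J) - fderiv ℝ G (f (γ 0)) (β J) (β L) (β N))) :
    contract (fun J K => G (f (γ 0)) (β J) (β K)) (ψ 0)
      (fun K => deriv (fun t => ψ t K) 0 + ∑ L, ∑ N,
        (β.coord L (fderiv ℝ f (γ 0) (deriv γ 0)) * Γ K L N) • ψ 0 N) = 0 := by
  have : FiniteDimensional ℝ E := Module.Finite.of_basis e
  have : FiniteDimensional ℝ W := Module.Finite.of_basis β
  have hf' : DifferentiableAt ℝ (fderiv ℝ f) (γ 0) :=
    (hf.fderiv_right (m := 1) (by norm_num)).differentiableAt (by simp)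
  have hγ' := hγ.hasDerivAt
  set w := deriv γ 0 with hw
  set A := fderiv ℝ f (γ 0) with hA
  set A₂ := fderiv ℝ (fderiv ℝ f) (γ 0) with hA₂
  have hAγ : HasDerivAt (fun t => fderiv ℝ f (γ t)) (A₂ w) 0 :=
    HasFDerivAt.comp_hasDerivAt (l := fderiv ℝ f) 0 hf'.hasFDerivAt hγ'
  have hχ (i : ι) : DifferentiableAt ℝ (fun t => coeff (e.coord i) (Θ t)) 0 := by
    refine differentiableAt_coeff e β hAγ.differentiableAt hinj (fun J => ?_) i
    exact (hψ J).congr_of_eventuallyEq (hψΘ.mono fun t ht => (ht J).symm)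
  set χ : ι → Λ := fun i => coeff (e.coord i) (Θ 0) with hχdef
  set χ' : ι → Λ := fun i => deriv (fun t => coeff (e.coord i) (Θ t)) 0 with hχ'def
  have hψ0 : ψ 0 = fun J => ∑ i, β.coord J (A (e i)) • χ i := by
    ext J
    rw [hψΘ.self_of_nhds J, coeff_eq_sum e]
    rfl
  have hψ' (J : κ) : deriv (fun t => ψ t J) 0 = (∑ i, β.coord J (A₂ w (e i)) • χ i)
      + ∑ i, β.coord J (A (e i)) • χ' i := by
    have h1 (i : ι) : HasDerivAt (fun t => β.coord J (fderiv ℝ f (γ t) (e i)))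
        (β.coord J (A₂ w (e i))) 0 := by
      have h2 := hAγ.clm_apply (hasDerivAt_const (0 : ℝ) (e i))
      simp only [map_zero, add_zero] at h2
      exact HasFDerivAt.comp_hasDerivAt (0 : ℝ)
        (LinearMap.toContinuousLinearMap (β.coord J)).hasFDerivAt h2
    have h2 : HasDerivAt (fun t => ∑ i, β.coord J (fderiv ℝ f (γ t) (e i)) •
        coeff (e.coord i) (Θ t)) _ 0 :=
      HasDerivAt.fun_sum fun i _ => (h1 i).smul (hχ i).hasDerivAt
    have h3 : (fun t => ψ t J) =ᶠ[𝓝 0] (fun t => ∑ i, β.coord J (fderiv ℝ f (γ t) (e i)) •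
        coeff (e.coord i) (Θ t)) := by
      filter_upwards [hψΘ] with t ht
      rw [ht J, coeff_eq_sum e]
      rfl
    rw [h3.deriv_eq, h2.deriv, ← Finset.sum_add_distrib]
    refine Finset.sum_congr rfl fun i _ => ?_
    rw [add_comm]
  -- The Christoffel term of the covariant derivative of `∂_i f` in the direction `w`.
  let v : ι → W := fun i =>
    ∑ K, (∑ L, ∑ N, β.coord L (A w) * Γ K L N * β.coord N (A (e i))) • β K
  have hv (M : κ) : ∑ L, ∑ N, (β.coord L (A w) * Γ M L N) • ψ 0 N
      = ∑ i, β.coord M (v i) • χ i := by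
    have h1 (i : ι) : β.coord M (v i)
        = ∑ L, ∑ N, β.coord L (A w) * Γ M L N * β.coord N (A (e i)) := by
      classical
      simp [v, Finsupp.single_apply]
    simp only [hψ0, h1, Finset.smul_sum, Finset.sum_smul, smul_smul]
    symm
    rw [Finset.sum_comm]
    exact Finset.sum_congr rfl fun L _ => Finset.sum_comm
  have hsplit : (fun M => deriv (fun t => ψ t M) 0 + ∑ L, ∑ N,
        (β.coord L (A w) * Γ M L N) • ψ 0 N) =
      (fun M => ∑ i, β.coord M (A₂ w (e i)) • χ i) + (fun M => ∑ i, β.coord M (A (e i)) • χ' i)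
        + (fun M => ∑ i, β.coord M (v i) • χ i) := by
    ext M
    rw [hv, hψ']
    rfl
  rw [hsplit, contract_add_right, contract_add_right, hψ0, contract_basis, contract_basis,
    contract_basis]
  have hB' : HasFDerivAt (fun y => pullbackForm G f y - F y)
      (fderiv ℝ (pullbackForm G f) (γ 0) - fderiv ℝ F (γ 0)) (γ 0) :=
    HasFDerivAt.sub (F := E →L[ℝ] E →L[ℝ] ℝ)
      (differentiableAt_pullbackForm hG hf).hasFDerivAt hF.hasFDerivAt
  have hB : DifferentiableAt ℝ (fun y => pullbackForm G f y - F y) (γ 0) := hB'.differentiableAt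
  have hdB (a b d : E) : fderiv ℝ (fun y => pullbackForm G f y - F y) (γ 0) a b d
      = fderiv ℝ (pullbackForm G f) (γ 0) a b d - fderiv ℝ F (γ 0) a b d := by
    rw [hB'.fderiv]
    rfl
  have hdF (a b d : E) : fderiv ℝ F (γ 0) a b d = - fderiv ℝ F (γ 0) a d b := by
    have h1 (b d : E) : HasFDerivAt (fun y => F y b d) _ (γ 0) :=
      (hF.hasFDerivAt.clm_apply (hasFDerivAt_const b _)).clm_apply (hasFDerivAt_const d _)
    have h2 := (h1 d b).neg
    have h3 : (fun y => F y b d) = -(fun y => F y d b) := by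
      ext y
      exact hFa y b d
    have h4 := h1 b d
    rw [h3] at h4
    simpa using congrArg (fun l => l a) (h4.unique h2)
  have hdh (a b d : E) : fderiv ℝ (pullbackForm G f) (γ 0) a b d
      = fderiv ℝ (pullbackForm G f) (γ 0) a d b := by
    have h0 := (differentiableAt_pullbackForm hG hf).hasFDerivAt
    have h1 (b d : E) : HasFDerivAt (fun y => pullbackForm G f y b d) _ (γ 0) :=
      (h0.clm_apply (hasFDerivAt_const b _)).clm_apply (hasFDerivAt_const d _)
    have h3 : (fun y => pullbackForm G f y b d) = (fun y => pullbackForm G f y d b) := by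
      ext y
      exact hGs _ _ _
    have h4 := h1 b d
    rw [h3] at h4
    simpa using congrArg (fun l => l a) (h4.unique (h1 d b))
  -- The gluing condition holds for all `t` near `0`, so it may be differentiated in `t`; this gives
  -- `hzero'`.
  have hzero : ∀ᶠ t in 𝓝 0, ∀ d, ∑ i, (pullbackForm G f (γ t) - F (γ t)) (e i) d •
      coeff (e.coord i) (Θ t) = 0 := by
    filter_upwards [hK, hΘ] with t ht hΘt d
    have h := coeff_eq_zero (Λ := Λ)
      (ℓ := ((pullbackForm G f (γ t) - F (γ t)).flip d : E →ₗ[ℝ] ℝ))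
      (fun u hu => by simpa [sub_eq_zero] using ht u hu d) hΘt
    rw [coeff_eq_sum e] at h
    exact h
  let DB := fderiv ℝ (fun y => pullbackForm G f y - F y) (γ 0)
  have hzero' (d : E) : ∑ i, (DB w (e i) d • χ i
      + (pullbackForm G f (γ 0) - F (γ 0)) (e i) d • χ' i) = 0 := by
    have h1 : HasDerivAt (fun t => pullbackForm G f (γ t) - F (γ t)) (DB w) 0 :=
      HasFDerivAt.comp_hasDerivAt (l := fun y => pullbackForm G f y - F y) 0 hB.hasFDerivAt hγ'
    have h2 (i : ι) : HasDerivAt (fun t => (pullbackForm G f (γ t) - F (γ t)) (e i) d)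
        (DB w (e i) d) 0 := by
      simpa using (h1.clm_apply (hasDerivAt_const (0 : ℝ) (e i))).clm_apply
        (hasDerivAt_const (0 : ℝ) d)
    have h3 : HasDerivAt (fun t => ∑ i, (pullbackForm G f (γ t) - F (γ t)) (e i) d •
        coeff (e.coord i) (Θ t)) _ 0 :=
      HasDerivAt.fun_sum fun i _ => (h2 i).smul (hχ i).hasDerivAt
    have h4 := h3.unique ((hasDerivAt_const (0 : ℝ) (0 : Λ)).congr_of_eventuallyEq
      (hzero.mono fun t ht => ht d))
    rw [← h4]
    exact Finset.sum_congr rfl fun i _ => add_comm _ _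
  -- The antisymmetrized derivative of `h - F`, contracted with `w`; by `hint` it vanishes on pairs
  -- of vectors in `K 0`.
  let T : E →ₗ[ℝ] E →ₗ[ℝ] ℝ := LinearMap.mk₂ ℝ (fun a b => DB b a w - DB a b w)
    (by intro a b c; simp only [map_add, add_apply]; ring)
    (by intro r a b; simp only [map_smul, smul_apply, smul_eq_mul]; ring)
    (by intro a b c; simp only [map_add, add_apply]; ring)
    (by intro r a b; simp only [map_smul, smul_apply, smul_eq_mul]; ring)
  have hT : contract (fun j i => T (e j) (e i)) χ χ = 0 :=
    contract_eq_zero e (fun u hu a ha => sub_eq_zero.2 (hint a ha u hu w))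
      hΘ.self_of_nhds hΘ.self_of_nhds
  have hfinal := contract_covariant_eq_zero (χ := χ) (χ' := χ')
    (h := fun i j => pullbackForm G f (γ 0) (e i) (e j)) (F := fun i j => F (γ 0) (e i) (e j))
    (D := fun i j => DB w (e i) (e j)) (C := fun j i => T (e j) (e i))
    (Dh := fun j i => fderiv ℝ (pullbackForm G f) (γ 0) w (e i) (e j)
      + fderiv ℝ (pullbackForm G f) (γ 0) (e i) w (e j)
      - fderiv ℝ (pullbackForm G f) (γ 0) (e j) w (e i))
    (fun i j => hGs _ _ _) (fun i j => hFa _ _ _) (fun j => hzero.self_of_nhds (e j))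
    (fun j => hzero' (e j)) hT
    -- Closedness rewrites `∂_w F_{ij}` as `∂_j F_{iw} - ∂_i F_{jw}`, which is the contribution of
    -- `F` to `T`.
    (fun i j => by
      simp only [T, DB, LinearMap.mk₂_apply, hdB]
      have h1 := hclosed w (e i) (e j)
      have h2 := hdF (e j) w (e i)
      have h3 := hdh (e i) w (e j)
      have h4 := hdh (e j) w (e i)
      linarith)
  -- Twice the lowered covariant derivative of `∂_i f` along `w`: the second derivative of `f` and
  -- the Christoffel correction `v` together.
  have hDh : (fun j i => fderiv ℝ (pullbackForm G f) (γ 0) w (e i) (e j)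
      + fderiv ℝ (pullbackForm G f) (γ 0) (e i) w (e j)
      - fderiv ℝ (pullbackForm G f) (γ 0) (e j) w (e i))
      = (2 : ℝ) • ((fun j i => G (f (γ 0)) (A (e j)) (A₂ w (e i)))
        + (fun j i => G (f (γ 0)) (A (e j)) (v i))) := by
    ext j i
    rw [koszul_pullbackForm hG hf hGs]
    simp only [Pi.smul_apply, Pi.add_apply, v, smul_eq_mul]
    rw [lower_christoffel β _ _ Γ hΓ]
    ring
  rw [hDh, contract_smul_form, ← smul_add, contract_add_form] at hfinal
  have h2 := (smul_eq_zero.1 hfinal).resolve_left (by norm_num)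
  rw [← h2]
  simp only [pullbackForm_apply]
  abel

end LocalTheorem

end Bibrane
end

noncomputable section

set_option maxSynthPendingDepth 3

namespace Bibrane

/-! ### Bilinear forms in coordinates, and the Christoffel symbols. -/

section CoordinateForm

variable {E : Type*} [NormedAddCommGroup E] [NormedSpace ℝ E] [FiniteDimensional ℝ E]
  {H : Type*} [TopologicalSpace H] {I : ModelWithCorners ℝ E H}
  {M : Type*} [TopologicalSpace M] [ChartedSpace H M]
  {ι : Type*} [Fintype ι]

/-- The coordinate expression of a field of bilinear forms, as a field of continuous bilinear
forms on the model space. -/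
def coordBilin (β : Module.Basis ι ℝ E) (B : ∀ p : M, TangentSpace I p → TangentSpace I p → ℝ)
    (c : OpenPartialHomeomorph M H) (x : E) : E →L[ℝ] E →L[ℝ] ℝ :=
  ∑ J, ∑ K, coordMatrix I β B c x J K •
    (LinearMap.toContinuousLinearMap (β.coord J)).smulRight
      (LinearMap.toContinuousLinearMap (β.coord K))

variable (β : Module.Basis ι ℝ E) (B : ∀ p : M, LinearMap.BilinForm ℝ (TangentSpace I p))
  (c : OpenPartialHomeomorph M H)

theorem coordBilin_apply (x a b : E) :
    coordBilin β (fun p u v => B p u v) c x a b = coordForm I (fun p u v => B p u v) c x a b := by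
  let T : E →ₗ[ℝ] E →ₗ[ℝ] ℝ :=
    (B ((c.extend I).symm x)).compl₁₂ (mfderiv 𝓘(ℝ, E) I (c.extend I).symm x).toLinearMap
      (mfderiv 𝓘(ℝ, E) I (c.extend I).symm x).toLinearMap
  change _ = T a b
  have h1 := congrArg T (β.sum_repr a)
  have h2 (J) := congrArg (T (β J)) (β.sum_repr b)
  rw [← h1]
  simp only [coordBilin, map_sum, map_smul, sum_apply, smul_apply, LinearMap.sum_apply,
    LinearMap.smul_apply, smul_eq_mul, ← h2, ContinuousLinearMap.smulRight_apply,
    LinearMap.coe_toContinuousLinearMap', Module.Basis.coord_apply, Finset.mul_sum]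
  refine Finset.sum_congr rfl fun J _ => Finset.sum_congr rfl fun K _ => ?_
  change T (β J) (β K) * _ = _
  ring

variable {β B c}

theorem differentiableAt_coordBilin {x : E}
    (h : ∀ a b, DifferentiableAt ℝ (fun z => coordForm I (fun p u v => B p u v) c z a b) x) :
    DifferentiableAt ℝ (coordBilin β (fun p u v => B p u v) c) x := by
  unfold coordBilin
  refine DifferentiableAt.fun_sum fun J _ => DifferentiableAt.fun_sum fun K _ => ?_
  exact (h (β J) (β K)).smul_const _

theorem fderiv_coordBilin_apply {x : E}
    (h : ∀ a b, DifferentiableAt ℝ (fun z => coordForm I (fun p u v => B p u v) c z a b) x)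
    (w a b : E) : fderiv ℝ (coordBilin β (fun p u v => B p u v) c) x w a b
      = fderiv ℝ (fun z => coordForm I (fun p u v => B p u v) c z a b) x w := by
  have h1 := (((differentiableAt_coordBilin (β := β) h).hasFDerivAt.clm_apply
    (hasFDerivAt_const a x)).clm_apply (hasFDerivAt_const b x)).fderiv
  simp only [coordBilin_apply] at h1
  rw [h1]
  simp

/-- A row vector annihilated by a singular matrix would be the components of a nonzero tangent
vector orthogonal to the whole tangent space. -/
theorem isUnit_det_coordMatrix [I.Boundaryless] [DecidableEq ι]
    (hc : c ∈ IsManifold.maximalAtlas I ∞ M) (hB : ∀ p u, (∀ v, B p u v = 0) → u = 0)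
    {x : E} (hx : x ∈ (c.extend I).target) :
    IsUnit (coordMatrix I β (fun p u v => B p u v) c x).det := by
  rw [isUnit_iff_ne_zero]
  intro hdet
  obtain ⟨v, hv0, hv⟩ := Matrix.exists_vecMul_eq_zero_iff.2 hdet
  let a : E := ∑ J, v J • β J
  have h1 (b : E) : coordForm I (fun p u v => B p u v) c x a b = 0 := by
    rw [← coordBilin_apply β]
    have h2 : coordBilin β (fun p u v => B p u v) c x a = 0 := by
      have h3 : (coordBilin β (fun p u v => B p u v) c x a : E →ₗ[ℝ] ℝ) = 0 := by
        refine β.ext fun K => ?_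
        have h4 := congrFun hv K
        simp only [Matrix.vecMul, dotProduct, Pi.zero_apply] at h4
        simp only [a, map_sum, map_smul, ContinuousLinearMap.coe_coe, sum_apply, smul_apply,
          coordBilin_apply, LinearMap.zero_apply]
        exact h4
      ext b
      exact congrArg (fun l => l b) h3
    rw [h2]
    rfl
  have h2 : coordVec I c x a = 0 := by
    refine hB _ _ fun w => ?_
    rw [← coordVec_mfderiv_extend hc hx w]
    exact h1 _
  have h3 : a = 0 := by
    rw [← mfderiv_extend_coordVec hc hx a, h2]
    exact map_zero _
  apply hv0
  ext J
  exact Fintype.linearIndependent_iff.1 β.linearIndependent v h3 J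

/-- Invertibility of the matrix of `B` is essential: it makes the matrix inverse in `christoffel` a
genuine one, which cancels when the index is lowered. -/
theorem sum_coordBilin_mul_christoffel [I.Boundaryless] [DecidableEq ι]
    (hc : c ∈ IsManifold.maximalAtlas I ∞ M) (hB : ∀ p u, (∀ v, B p u v = 0) → u = 0)
    {x : E} (hx : x ∈ (c.extend I).target)
    (h : ∀ a b, DifferentiableAt ℝ (fun z => coordForm I (fun p u v => B p u v) c z a b) x)
    (J L N : ι) :
    ∑ K, coordBilin β (fun p u v => B p u v) c x (β J) (β K) *
        christoffel I β (fun p u v => B p u v) c x K L N =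
      (1 / 2 : ℝ) * (fderiv ℝ (coordBilin β (fun p u v => B p u v) c) x (β L) (β N) (β J)
        + fderiv ℝ (coordBilin β (fun p u v => B p u v) c) x (β N) (β L) (β J)
        - fderiv ℝ (coordBilin β (fun p u v => B p u v) c) x (β J) (β L) (β N)) := by
  set m := coordMatrix I β (fun p u v => B p u v) c x with hm
  have h1 := Matrix.mul_nonsing_inv m (isUnit_det_coordMatrix hc hB hx)
  have h2 (P : ι) : ∑ K, m J K * m⁻¹ K P = if J = P then 1 else 0 := by
    rw [← Matrix.mul_apply, h1, Matrix.one_apply]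
  have h3 (K : ι) : coordBilin β (fun p u v => B p u v) c x (β J) (β K) = m J K :=
    coordBilin_apply _ _ _ _ _ _
  simp only [fderiv_coordBilin_apply h, h3, christoffel, ← hm]
  set R : ι → ℝ := fun P =>
    fderiv ℝ (fun z => coordMatrix I β (fun p u v => B p u v) c z N P) x (β L)
    + fderiv ℝ (fun z => coordMatrix I β (fun p u v => B p u v) c z L P) x (β N)
    - fderiv ℝ (fun z => coordMatrix I β (fun p u v => B p u v) c z L N) x (β P) with hR
  calc _ = (1 / 2 : ℝ) * ∑ P, (∑ K, m J K * m⁻¹ K P) * R P := by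
        simp only [Finset.mul_sum, Finset.sum_mul]
        rw [Finset.sum_comm]
        refine Finset.sum_congr rfl fun P _ => Finset.sum_congr rfl fun K _ => ?_
        ring
    _ = (1 / 2 : ℝ) * R J := by simp [h2]
    _ = _ := rfl

end CoordinateForm

/-! ### Symmetry, nondegeneracy and regularity of the product metric. -/

section ProductMetric

variable {n : ℕ}
  {X : Type*} [TopologicalSpace X] [ChartedSpace (EuclideanSpace ℝ (Fin n)) X]
  [IsManifold (𝓡 n) ∞ X]
  {X' : Type*} [TopologicalSpace X'] [ChartedSpace (EuclideanSpace ℝ (Fin n)) X']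
  [IsManifold (𝓡 n) ∞ X']
  (g : PseudoRiemannianMetric (𝓡 n) X) (g' : PseudoRiemannianMetric (𝓡 n) X')

theorem productMetric_symm (p : X × X') (u v : TangentSpace (prodModel n) p) :
    productMetric g g' p u v = productMetric g g' p v u := by
  simp only [productMetric, LinearMap.mk₂_apply]
  rw [g.symm, g'.symm]

theorem productMetric_nondegenerate (p : X × X') (u : TangentSpace (prodModel n) p)
    (hu : ∀ v, productMetric g g' p u v = 0) : u = 0 := by
  simp only [productMetric, LinearMap.mk₂_apply, mfderiv_fst, mfderiv_snd] at hu
  have h1 : u.1 = 0 := by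
    refine g.nondegenerate p.1 _ fun v => ?_
    -- Testing against vectors tangent to one factor separates the two metrics.
    have h : g.form p.1 u.1 v - g'.form p.2 u.2 0 = 0 := hu (v, 0)
    rwa [map_zero, sub_zero] at h
  have h2 : u.2 = 0 := by
    refine g'.nondegenerate p.2 _ fun v => ?_
    have h : g.form p.1 u.1 0 - g'.form p.2 u.2 v = 0 := hu (0, v)
    rwa [map_zero, zero_sub, neg_eq_zero] at h
  exact Prod.ext h1 h2

variable {c : OpenPartialHomeomorph (X × X') (ModelProd (EuclideanSpace ℝ (Fin n))
    (EuclideanSpace ℝ (Fin n)))}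

theorem differentiableAt_coordForm_productMetric
    (hc : c ∈ IsManifold.maximalAtlas (prodModel n) ∞ (X × X'))
    {x : EuclideanSpace ℝ (Fin n) × EuclideanSpace ℝ (Fin n)}
    (hx : x ∈ (c.extend (prodModel n)).target)
    (a b : EuclideanSpace ℝ (Fin n) × EuclideanSpace ℝ (Fin n)) :
    DifferentiableAt ℝ
      (fun z => coordForm (prodModel n) (fun p u v => productMetric g g' p u v) c z a b) x := by
  have hs : ContMDiffOn 𝓘(ℝ, EuclideanSpace ℝ (Fin n) × EuclideanSpace ℝ (Fin n)) (prodModel n) ∞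
      (c.extend (prodModel n)).symm (c.extend (prodModel n)).target :=
    fun z hz => (contMDiffAt_extend_symm hc hz).contMDiffWithinAt
  have hU : IsOpen (c.extend (prodModel n)).target := c.isOpen_extend_target
  have h1 := differentiableAt_form_mfderiv g.contMDiff hU
    (contMDiff_fst.comp_contMDiffOn hs) hx a b
  have h2 := differentiableAt_form_mfderiv g'.contMDiff hU
    (contMDiff_snd.comp_contMDiffOn hs) hx a b
  refine (h1.fun_sub h2).congr_of_eventuallyEq ?_
  filter_upwards [hU.mem_nhds hx] with z hz
  have hz' := (contMDiffAt_extend_symm hc hz).mdifferentiableAt (by simp)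
  rw [mfderiv_comp z mdifferentiableAt_fst hz', mfderiv_comp z mdifferentiableAt_snd hz']
  rfl

end ProductMetric

/-! ### The embedding, the 2-form and `R₊` in charts. -/

section LocalRepresentative

variable {n k : ℕ}
  {X : Type*} [TopologicalSpace X] [ChartedSpace (EuclideanSpace ℝ (Fin n)) X]
  [IsManifold (𝓡 n) ∞ X]
  {X' : Type*} [TopologicalSpace X'] [ChartedSpace (EuclideanSpace ℝ (Fin n)) X']
  [IsManifold (𝓡 n) ∞ X']
  {Y : Type*} [TopologicalSpace Y] [ChartedSpace (EuclideanSpace ℝ (Fin k)) Y]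
  [IsManifold (𝓡 k) ∞ Y]
  {g : PseudoRiemannianMetric (𝓡 n) X} {g' : PseudoRiemannianMetric (𝓡 n) X'}
  {F : ClosedTwoForm (𝓡 k) Y} {e : Y → X × X'}
  {c : OpenPartialHomeomorph (X × X') (ModelProd (EuclideanSpace ℝ (Fin n))
    (EuclideanSpace ℝ (Fin n)))}
  {d : OpenPartialHomeomorph Y (EuclideanSpace ℝ (Fin k))}

/-- The expression of `e` in the charts `d` and `c`. -/
def localRep (d : OpenPartialHomeomorph Y (EuclideanSpace ℝ (Fin k))) (e : Y → X × X')
    (c : OpenPartialHomeomorph (X × X') (ModelProd (EuclideanSpace ℝ (Fin n))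
      (EuclideanSpace ℝ (Fin n)))) (y : EuclideanSpace ℝ (Fin k)) :
    EuclideanSpace ℝ (Fin n) × EuclideanSpace ℝ (Fin n) :=
  c.extend (prodModel n) (e ((d.extend (𝓡 k)).symm y))

omit [ChartedSpace (EuclideanSpace ℝ (Fin n)) X] [ChartedSpace (EuclideanSpace ℝ (Fin n)) X']
  [ChartedSpace (EuclideanSpace ℝ (Fin k)) Y] [IsManifold (𝓡 n) ∞ X] [IsManifold (𝓡 n) ∞ X']
  [IsManifold (𝓡 k) ∞ Y] in
theorem localRep_extend {p : Y} (hp : p ∈ d.source) :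
    localRep d e c (d.extend (𝓡 k) p) = c.extend (prodModel n) (e p) := by
  rw [localRep, d.extend_left_inv hp]

omit [IsManifold (𝓡 n) ∞ X] [IsManifold (𝓡 n) ∞ X'] [IsManifold (𝓡 k) ∞ Y] in
theorem contDiffAt_localRep (hd : d ∈ IsManifold.maximalAtlas (𝓡 k) ∞ Y)
    (hc : c ∈ IsManifold.maximalAtlas (prodModel n) ∞ (X × X'))
    (he : ContMDiff (𝓡 k) (prodModel n) ∞ e) {p : Y} (hp : p ∈ d.source)
    (hep : e p ∈ c.source) : ContDiffAt ℝ ∞ (localRep d e c) (d.extend (𝓡 k) p) := by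
  obtain ⟨y, hy, rfl⟩ := exists_extend_symm_eq (I := 𝓡 k) hp
  rw [(d.extend (𝓡 k)).right_inv hy]
  have h1 := contMDiffAt_extend_symm hd hy
  have h2 := he.contMDiffAt.comp y h1
  exact ((c.contMDiffAt_extend hc hep).comp y h2).contDiffAt

omit [IsManifold (𝓡 n) ∞ X] [IsManifold (𝓡 n) ∞ X'] [IsManifold (𝓡 k) ∞ Y] in
theorem fderiv_localRep_apply (hd : d ∈ IsManifold.maximalAtlas (𝓡 k) ∞ Y)
    (hc : c ∈ IsManifold.maximalAtlas (prodModel n) ∞ (X × X'))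
    (he : ContMDiff (𝓡 k) (prodModel n) ∞ e) {p : Y} (hp : p ∈ d.source)
    (hep : e p ∈ c.source) (u : TangentSpace (𝓡 k) p) :
    fderiv ℝ (localRep d e c) (d.extend (𝓡 k) p)
        (mfderiv (𝓡 k) 𝓘(ℝ, EuclideanSpace ℝ (Fin k)) (d.extend (𝓡 k)) p u)
      = mfderiv (prodModel n) 𝓘(ℝ, EuclideanSpace ℝ (Fin n) × EuclideanSpace ℝ (Fin n))
          (c.extend (prodModel n)) (e p) (pushforward e p u) := by
  have h1 := (contDiffAt_localRep hd hc he hp hep).contMDiffAt.mdifferentiableAt (by simp)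
  have h2 := (d.contMDiffAt_extend hd hp).mdifferentiableAt (by simp)
  have h3 := (c.contMDiffAt_extend hc hep).mdifferentiableAt (by simp)
  have h4 := (he p).mdifferentiableAt (by simp)
  have h5 : localRep d e c ∘ d.extend (𝓡 k) =ᶠ[𝓝 p] c.extend (prodModel n) ∘ e := by
    filter_upwards [d.open_source.mem_nhds hp] with q hq
    exact localRep_extend hq
  have h6 := h5.mfderiv_eq (I := 𝓡 k)
    (I' := 𝓘(ℝ, EuclideanSpace ℝ (Fin n) × EuclideanSpace ℝ (Fin n)))
  rw [mfderiv_comp p h1 h2, mfderiv_comp p h3 h4, mfderiv_eq_fderiv] at h6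
  exact congrArg (fun l => l u) h6

/-- The coordinate expression of the metric. -/
abbrev metricBilin (g : PseudoRiemannianMetric (𝓡 n) X) (g' : PseudoRiemannianMetric (𝓡 n) X')
    (c : OpenPartialHomeomorph (X × X') (ModelProd (EuclideanSpace ℝ (Fin n))
      (EuclideanSpace ℝ (Fin n)))) :=
  coordBilin (I := prodModel n) (prodBasis n) (fun p u v => productMetric g g' p u v) c

/-- The coordinate expression of the 2-form. -/
abbrev formBilin (F : ClosedTwoForm (𝓡 k) Y)
    (d : OpenPartialHomeomorph Y (EuclideanSpace ℝ (Fin k))) :=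
  coordBilin (I := 𝓡 k) (EuclideanSpace.basisFun (Fin k) ℝ).toBasis
    (fun p u v => (F.form p).toLinearMap₁₂ u v) d

omit [IsManifold (𝓡 k) ∞ Y] in
theorem pullbackForm_localRep (hd : d ∈ IsManifold.maximalAtlas (𝓡 k) ∞ Y)
    (hc : c ∈ IsManifold.maximalAtlas (prodModel n) ∞ (X × X'))
    (he : ContMDiff (𝓡 k) (prodModel n) ∞ e) {p : Y} (hp : p ∈ d.source)
    (hep : e p ∈ c.source) (u w : TangentSpace (𝓡 k) p) :
    pullbackForm (metricBilin g g' c) (localRep d e c) (d.extend (𝓡 k) p)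
        (mfderiv (𝓡 k) 𝓘(ℝ, EuclideanSpace ℝ (Fin k)) (d.extend (𝓡 k)) p u)
        (mfderiv (𝓡 k) 𝓘(ℝ, EuclideanSpace ℝ (Fin k)) (d.extend (𝓡 k)) p w)
      = productMetric g g' (e p) (pushforward e p u) (pushforward e p w) := by
  refine (coordBilin_apply (prodBasis n) (productMetric g g') c _ _ _).trans ?_
  exact coordForm_extend (fun p u v => productMetric g g' p u v) hc hep _ _
    (localRep_extend hp) (fderiv_localRep_apply hd hc he hp hep u)
    (fderiv_localRep_apply hd hc he hp hep w)

theorem formBilin_extend (hd : d ∈ IsManifold.maximalAtlas (𝓡 k) ∞ Y) {p : Y} (hp : p ∈ d.source)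
    (u w : TangentSpace (𝓡 k) p) :
    formBilin F d (d.extend (𝓡 k) p)
        (mfderiv (𝓡 k) 𝓘(ℝ, EuclideanSpace ℝ (Fin k)) (d.extend (𝓡 k)) p u)
        (mfderiv (𝓡 k) 𝓘(ℝ, EuclideanSpace ℝ (Fin k)) (d.extend (𝓡 k)) p w)
      = F.form p u w := by
  refine (coordBilin_apply _ (fun p => (F.form p).toLinearMap₁₂) d _ _ _).trans ?_
  exact coordForm_extend (fun p u v => (F.form p).toLinearMap₁₂ u v) hd hp _ _ rfl rfl rfl

theorem pullbackForm_eq_formBilin (hd : d ∈ IsManifold.maximalAtlas (𝓡 k) ∞ Y)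
    (hc : c ∈ IsManifold.maximalAtlas (prodModel n) ∞ (X × X'))
    (he : ContMDiff (𝓡 k) (prodModel n) ∞ e) {p : Y} (hp : p ∈ d.source)
    (hep : e p ∈ c.source) {u : TangentSpace (𝓡 k) p} (hu : u ∈ Rplus g g' F e p)
    (w : EuclideanSpace ℝ (Fin k)) :
    pullbackForm (metricBilin g g' c) (localRep d e c) (d.extend (𝓡 k) p)
        (mfderiv (𝓡 k) 𝓘(ℝ, EuclideanSpace ℝ (Fin k)) (d.extend (𝓡 k)) p u) w
      = formBilin F d (d.extend (𝓡 k) p)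
        (mfderiv (𝓡 k) 𝓘(ℝ, EuclideanSpace ℝ (Fin k)) (d.extend (𝓡 k)) p u) w := by
  obtain ⟨w', rfl⟩ := mfderiv_extend_surjective hd hp w
  exact (pullbackForm_localRep hd hc he hp hep u w').trans
    ((hu w').trans (formBilin_extend hd hp u w').symm)

theorem differentiableAt_metricBilin
    (hc : c ∈ IsManifold.maximalAtlas (prodModel n) ∞ (X × X'))
    {x : EuclideanSpace ℝ (Fin n) × EuclideanSpace ℝ (Fin n)}
    (hx : x ∈ (c.extend (prodModel n)).target) :
    DifferentiableAt ℝ (metricBilin g g' c) x :=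
  differentiableAt_coordBilin (differentiableAt_coordForm_productMetric g g' hc hx)

theorem differentiableAt_coordForm_closedTwoForm (hd : d ∈ IsManifold.maximalAtlas (𝓡 k) ∞ Y)
    {y : EuclideanSpace ℝ (Fin k)} (hy : y ∈ (d.extend (𝓡 k)).target)
    (a b : EuclideanSpace ℝ (Fin k)) : DifferentiableAt ℝ
      (fun z => coordForm (𝓡 k) (fun p u v => (F.form p).toLinearMap₁₂ u v) d z a b) y :=
  differentiableAt_coordForm F.contMDiff hd hy a b

/-- Integrability of `R₊`: the derivative of the difference of the metric and the 2-form is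
symmetric in two directions of `R₊`. -/
theorem fderiv_symm_of_isIntegrable (hd : d ∈ IsManifold.maximalAtlas (𝓡 k) ∞ Y)
    (hc : c ∈ IsManifold.maximalAtlas (prodModel n) ∞ (X × X'))
    (he : ContMDiff (𝓡 k) (prodModel n) ∞ e)
    (hint : IsIntegrable (𝓡 k) (Rplus g g' F e)) {p : Y} (hp : p ∈ d.source)
    (hep : e p ∈ c.source)
    {u v : TangentSpace (𝓡 k) p} (hu : u ∈ Rplus g g' F e p) (hv : v ∈ Rplus g g' F e p)
    {a b : EuclideanSpace ℝ (Fin k)}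
    (ha : a = mfderiv (𝓡 k) 𝓘(ℝ, EuclideanSpace ℝ (Fin k)) (d.extend (𝓡 k)) p u)
    (hb : b = mfderiv (𝓡 k) 𝓘(ℝ, EuclideanSpace ℝ (Fin k)) (d.extend (𝓡 k)) p v)
    (w : EuclideanSpace ℝ (Fin k)) :
    fderiv ℝ (fun y => pullbackForm (metricBilin g g' c) (localRep d e c) y - formBilin F d y)
        (d.extend (𝓡 k) p) a b w
      = fderiv ℝ (fun y => pullbackForm (metricBilin g g' c) (localRep d e c) y - formBilin F d y)
        (d.extend (𝓡 k) p) b a w := by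
  obtain ⟨r, U, j, hU, h0, rfl, hj, hjU⟩ := hint p
  have hfd : ContDiffAt ℝ 2 (localRep d e c) (d.extend (𝓡 k) (j 0)) :=
    (contDiffAt_localRep hd hc he hp hep).of_le (by norm_cast)
  have hB : DifferentiableAt ℝ (fun y => pullbackForm (metricBilin g g' c) (localRep d e c) y
      - formBilin F d y) (d.extend (𝓡 k) (j 0)) := by
    refine (differentiableAt_pullbackForm ?_ hfd).fun_sub ?_
    · rw [localRep_extend hp]
      refine differentiableAt_metricBilin hc ((c.extend (prodModel n)).map_source ?_)
      rwa [c.extend_source]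
    · refine differentiableAt_coordBilin (differentiableAt_coordForm_closedTwoForm hd
        ((d.extend (𝓡 k)).map_source ?_))
      rwa [d.extend_source]
  let jl : EuclideanSpace ℝ (Fin r) → EuclideanSpace ℝ (Fin k) := fun x => d.extend (𝓡 k) (j x)
  have hj0 := hj.contMDiffAt (hU.mem_nhds h0)
  have hjl : ContDiffAt ℝ 2 jl 0 :=
    (((d.contMDiffAt_extend hd hp).comp 0 hj0).contDiffAt).of_le (by norm_cast)
  have hder {x : EuclideanSpace ℝ (Fin r)} (hx : x ∈ U) (hjx : j x ∈ d.source)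
      (s : EuclideanSpace ℝ (Fin r)) : fderiv ℝ jl x s =
        mfderiv (𝓡 k) 𝓘(ℝ, EuclideanSpace ℝ (Fin k)) (d.extend (𝓡 k)) (j x)
          (mfderiv (𝓡 r) (𝓡 k) j x s) := by
    have h1 := mfderiv_comp x ((d.contMDiffAt_extend hd hjx).mdifferentiableAt (by simp))
      ((hj.contMDiffAt (hU.mem_nhds hx)).mdifferentiableAt (by simp))
    have h2 : mfderiv (𝓡 r) 𝓘(ℝ, EuclideanSpace ℝ (Fin k)) jl x = fderiv ℝ jl x :=
      mfderiv_eq_fderiv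
    rw [← h2]
    exact congrArg (fun l => l s) h1
  have hmem {x : EuclideanSpace ℝ (Fin r)} (hx : x ∈ U) (s : EuclideanSpace ℝ (Fin r)) :
      mfderiv (𝓡 r) (𝓡 k) j x s ∈ Rplus g g' F e (j x) := by
    rw [← (hjU x hx).2]
    exact LinearMap.mem_range_self _ _
  -- The tangent vectors of the integral submanifold lie in `R₊`, which in charts is the left kernel
  -- of the metric minus the 2-form.
  have hker : ∀ᶠ z in 𝓝 0, ∀ s w, (pullbackForm (metricBilin g g' c) (localRep d e c) (jl z)
      - formBilin F d (jl z)) (fderiv ℝ jl z s) w = 0 := by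
    have hcont := hj0.continuousAt
    filter_upwards [hU.mem_nhds h0, hcont.eventually (d.open_source.mem_nhds hp),
      (he.continuous.continuousAt.comp hcont).eventually (c.open_source.mem_nhds hep)]
      with z hzU hzd hzc s w
    rw [hder hzU hzd]
    exact sub_eq_zero.2 (pullbackForm_eq_formBilin hd hc he hzd hzc (hmem hzU s) w)
  rw [← (hjU 0 h0).2] at hu hv
  obtain ⟨s, rfl⟩ := hu
  obtain ⟨t, rfl⟩ := hv
  have h := fderiv_symm_of_mem_ker (j := jl) hB hjl hker s t w
  obtain rfl : a = fderiv ℝ jl 0 s := ha.trans (hder h0 hp s).symm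
  obtain rfl : b = fderiv ℝ jl 0 t := hb.trans (hder h0 hp t).symm
  exact h

/-- The fermion is lifted through `pushforward` to a vector tangent to `Y`, then moved to the model
space by the chart `d`. The lift needs only surjectivity of `R₊` onto its image. -/
theorem exists_coeff_of_mem_RplusTarget {Λ : Type*} [NormedRing Λ] [NormedAlgebra ℝ Λ]
    (hd : d ∈ IsManifold.maximalAtlas (𝓡 k) ∞ Y)
    (hc : c ∈ IsManifold.maximalAtlas (prodModel n) ∞ (X × X'))
    (he : ContMDiff (𝓡 k) (prodModel n) ∞ e) {p : Y} (hp : p ∈ d.source)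
    (hep : e p ∈ c.source) {ψ : Λ ⊗[ℝ] TangentSpace (prodModel n) (e p)}
    (hψ : ψ ∈ (RplusTarget g g' F e p).baseChange Λ) :
    ∃ Θ : Λ ⊗[ℝ] EuclideanSpace ℝ (Fin k),
      Θ ∈ ((Rplus g g' F e p).map (mfderiv (𝓡 k) 𝓘(ℝ, EuclideanSpace ℝ (Fin k))
        (d.extend (𝓡 k)) p).toLinearMap).baseChange Λ ∧
      ∀ J, fermionComponent (prodModel n) (prodBasis n) Λ c (e p) ψ J
        = coeff ((prodBasis n).coord J ∘ₗ
          (fderiv ℝ (localRep d e c) (d.extend (𝓡 k) p)).toLinearMap) Θ := by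
  obtain ⟨Θ', hΘ', rfl⟩ := exists_of_mem_baseChange_map (pushforward e p) hψ
  let D : TangentSpace (𝓡 k) p →ₗ[ℝ] EuclideanSpace ℝ (Fin k) :=
    (mfderiv (𝓡 k) 𝓘(ℝ, EuclideanSpace ℝ (Fin k)) (d.extend (𝓡 k)) p).toLinearMap
  refine ⟨LinearMap.lTensor Λ D Θ', ?_, fun J => ?_⟩
  · refine baseChange_induction (P := fun Θ' => LinearMap.lTensor Λ D Θ' ∈
      ((Rplus g g' F e p).map D).baseChange Λ) (by simp) ?_ ?_ hΘ'
    · intro x y hx hy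
      rw [map_add]
      exact add_mem hx hy
    · intro a v hv
      exact Submodule.tmul_mem_baseChange_of_mem a (Submodule.mem_map_of_mem hv)
  · rw [coeff_lTensor]
    change coeff (vecComponent (prodModel n) (prodBasis n) c (e p) J)
      (LinearMap.lTensor Λ (pushforward e p) Θ') = _
    rw [coeff_lTensor]
    congr 1
    ext u
    exact congrArg ((prodBasis n).coord J) (fderiv_localRep_apply hd hc he hp hep u).symm

end LocalRepresentative

end Bibrane

end

noncomputable section

set_option maxSynthPendingDepth 3

namespace Bibrane

/-! ### From coordinates back to the manifold. -/

theorem boundaryTerm_eq_zero {n k : ℕ}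
    {X : Type*} [TopologicalSpace X] [ChartedSpace (EuclideanSpace ℝ (Fin n)) X]
    [IsManifold (𝓡 n) ∞ X]
    {X' : Type*} [TopologicalSpace X'] [ChartedSpace (EuclideanSpace ℝ (Fin n)) X']
    [IsManifold (𝓡 n) ∞ X']
    {Y : Type*} [TopologicalSpace Y] [ChartedSpace (EuclideanSpace ℝ (Fin k)) Y]
    [IsManifold (𝓡 k) ∞ Y]
    {g : PseudoRiemannianMetric (𝓡 n) X} {g' : PseudoRiemannianMetric (𝓡 n) X'}
    {F : ClosedTwoForm (𝓡 k) Y} {e : Y → X × X'}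
    (he : Manifold.IsImmersion (𝓡 k) (prodModel n) ∞ e)
    (hint : IsIntegrable (𝓡 k) (Rplus g g' F e))
    {Λ : Type*} [NormedRing Λ] [NormedAlgebra ℝ Λ] {D : Type*}
    (V : AllowedVariation g g' F e Λ D) (σ : D)
    {c : OpenPartialHomeomorph (X × X') (ModelProd (EuclideanSpace ℝ (Fin n))
      (EuclideanSpace ℝ (Fin n)))}
    (hc : c ∈ IsManifold.maximalAtlas (prodModel n) ∞ (X × X'))
    (hσ : e (V.φ 0 σ) ∈ c.source) :
    V.boundaryTerm c σ = 0 := by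
  have hes : ContMDiff (𝓡 k) (prodModel n) ∞ e := he.contMDiff
  let d := chartAt (EuclideanSpace ℝ (Fin k)) (V.φ 0 σ)
  have hdA : d ∈ atlas (EuclideanSpace ℝ (Fin k)) Y := chart_mem_atlas _ _
  have hd : d ∈ IsManifold.maximalAtlas (𝓡 k) ∞ Y := IsManifold.chart_mem_maximalAtlas _
  have hp : V.φ 0 σ ∈ d.source := mem_chart_source _ _
  let f := localRep d e c
  let γ : ℝ → EuclideanSpace ℝ (Fin k) := fun t => d.extend (𝓡 k) (V.φ t σ)
  have hfγ : f (γ 0) = V.coords c σ := localRep_extend hp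
  have hct : V.coords c σ ∈ (c.extend (prodModel n)).target :=
    (c.extend (prodModel n)).map_source (by rwa [c.extend_source])
  have hdt : γ 0 ∈ (d.extend (𝓡 k)).target :=
    (d.extend (𝓡 k)).map_source (by rwa [d.extend_source])
  have hG := differentiableAt_coordForm_productMetric g g' hc hct
  have hF := differentiableAt_coordForm_closedTwoForm (F := F) hd hdt
  have hγ : DifferentiableAt ℝ γ 0 :=
    (((d.contMDiffAt_extend hd hp).mdifferentiableAt (by simp)).comp (0 : ℝ)
      (V.bosonDiff σ)).differentiableAt
  have hcont : ContinuousAt (fun t => V.φ t σ) 0 := (V.bosonDiff σ).continuousAt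
  have hgood : ∀ᶠ t in 𝓝 0, V.φ t σ ∈ d.source ∧ e (V.φ t σ) ∈ c.source :=
    (hcont.eventually (d.open_source.mem_nhds hp)).and
      ((hes.continuous.continuousAt.comp hcont).eventually (c.open_source.mem_nhds hσ))
  let K : ℝ → Submodule ℝ (EuclideanSpace ℝ (Fin k)) := fun t =>
    (Rplus g g' F e (V.φ t σ)).map (mfderiv (𝓡 k) 𝓘(ℝ, EuclideanSpace ℝ (Fin k))
      (d.extend (𝓡 k)) (V.φ t σ)).toLinearMap
  -- Away from `t = 0` the fields may leave the charts; `Θ` is then given the value `0`, which does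
  -- not affect germs at `t = 0`.
  have hex (t : ℝ) : ∃ Θ : Λ ⊗[ℝ] EuclideanSpace ℝ (Fin k),
      V.φ t σ ∈ d.source ∧ e (V.φ t σ) ∈ c.source → Θ ∈ (K t).baseChange Λ ∧
      ∀ J, fermionComponent (prodModel n) (prodBasis n) Λ c (e (V.φ t σ)) (V.ψ t σ) J
        = coeff ((prodBasis n).coord J ∘ₗ (fderiv ℝ f (γ t)).toLinearMap) Θ := by
    by_cases ht : V.φ t σ ∈ d.source ∧ e (V.φ t σ) ∈ c.source
    · obtain ⟨Θ, hΘ⟩ := exists_coeff_of_mem_RplusTarget hd hc hes ht.1 ht.2 (V.gluing t σ)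
      exact ⟨Θ, fun _ => hΘ⟩
    · exact ⟨0, fun h => absurd h ht⟩
  choose Θ hΘ using hex
  have hinj : Function.Injective (fderiv ℝ f (γ 0)) := by
    intro a b hab
    obtain ⟨u, rfl⟩ := mfderiv_extend_surjective hd hp a
    obtain ⟨v, rfl⟩ := mfderiv_extend_surjective hd hp b
    have h1 := (fderiv_localRep_apply hd hc hes hp hσ u).symm.trans
      (hab.trans (fderiv_localRep_apply hd hc hes hp hσ v))
    have h2 := mfderiv_injective_of_isImmersionAt (he.isImmersionAt _)
      (mfderiv_extend_injective hc hσ h1)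
    rw [h2]
  have hmain := contract_deltaCov_eq_zero (EuclideanSpace.basisFun (Fin k) ℝ).toBasis
    (prodBasis n) (G := metricBilin g g' c) (F := formBilin F d) (f := f) (γ := γ)
    (hfγ ▸ differentiableAt_metricBilin hc hct) (differentiableAt_coordBilin hF)
    ((contDiffAt_localRep hd hc hes hp hσ).of_le (by norm_cast)) hγ hinj
    (fun x a b => by
      rw [metricBilin, coordBilin_apply, coordBilin_apply]
      exact productMetric_symm g g' _ _ _)
    (fun y a b => by
      rw [formBilin, coordBilin_apply, coordBilin_apply]
      have h := F.alternating ((d.extend (𝓡 k)).symm y)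
      have h1 := h (coordVec (𝓡 k) d y a + coordVec (𝓡 k) d y b)
      simp only [map_add, add_apply, h] at h1
      rw [zero_add, add_zero] at h1
      exact eq_neg_of_add_eq_zero_right h1)
    (fun a b v => by
      rw [fderiv_coordBilin_apply hF, fderiv_coordBilin_apply hF, fderiv_coordBilin_apply hF]
      exact F.closed d hdA (γ 0) hdt a b v)
    K
    (hgood.mono fun t ht => by
      rintro _ ⟨u, hu, rfl⟩ w
      exact pullbackForm_eq_formBilin hd hc hes ht.1 ht.2 hu w)
    (by
      rintro _ ⟨u, hu, rfl⟩ _ ⟨v, hv, rfl⟩ w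
      exact fderiv_symm_of_isIntegrable hd hc hes hint hp hσ hu hv rfl rfl w)
    (Θ := Θ) (hgood.mono fun t ht => (hΘ t ht).1)
    (ψ := fun t J => fermionComponent (prodModel n) (prodBasis n) Λ c (e (V.φ t σ)) (V.ψ t σ) J)
    (fun J => V.fermionDiff σ c hc hσ J) (hgood.mono fun t ht => (hΘ t ht).2)
    (Γ := christoffel (prodModel n) (prodBasis n) (fun p u v => productMetric g g' p u v) c
      (V.coords c σ))
    (by
      rw [hfγ]
      exact sum_coordBilin_mul_christoffel hc (productMetric_nondegenerate g g') hct hG)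
  -- The variation `δφ` is the image under `df` of the velocity of the path in `Y`.
  have hδ (L : Fin n ⊕ Fin n) :
      (prodBasis n).coord L (fderiv ℝ f (γ 0) (deriv γ 0)) = V.deltaPhi c σ L := by
    have hfd := ((contDiffAt_localRep hd hc hes hp hσ).differentiableAt (by simp)).hasFDerivAt
    have h1 : HasDerivAt (fun t => f (γ t)) (fderiv ℝ f (γ 0) (deriv γ 0)) 0 :=
      HasFDerivAt.comp_hasDerivAt (l := f) 0 hfd hγ.hasDerivAt
    have h2 : HasDerivAt (fun t => (prodBasis n).coord L (f (γ t)))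
        ((prodBasis n).coord L (fderiv ℝ f (γ 0) (deriv γ 0))) 0 :=
      HasFDerivAt.comp_hasDerivAt (0 : ℝ)
        (LinearMap.toContinuousLinearMap ((prodBasis n).coord L)).hasFDerivAt h1
    rw [← h2.deriv, AllowedVariation.deltaPhi]
    refine Filter.EventuallyEq.deriv_eq (hgood.mono fun t ht => ?_)
    exact congrArg ((prodBasis n).coord L) (localRep_extend ht.1)
  have hM (J L : Fin n ⊕ Fin n) :
      metricBilin g g' c (V.coords c σ) (prodBasis n J) (prodBasis n L)
        = coordMatrix (prodModel n) (prodBasis n) (fun p u v => productMetric g g' p u v) c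
          (V.coords c σ) J L := coordBilin_apply _ _ _ _ _ _
  simp only [hδ, hfγ, hM] at hmain
  exact hmain

end Bibrane

end

theorem mainTheorem9 {n k : ℕ}
    {X : Type*} [TopologicalSpace X] [ChartedSpace (EuclideanSpace ℝ (Fin n)) X]
    [IsManifold (𝓡 n) ∞ X]
    {X' : Type*} [TopologicalSpace X'] [ChartedSpace (EuclideanSpace ℝ (Fin n)) X']
    [IsManifold (𝓡 n) ∞ X']
    {Y : Type*} [TopologicalSpace Y] [ChartedSpace (EuclideanSpace ℝ (Fin k)) Y]
    [IsManifold (𝓡 k) ∞ Y]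
    (g : Bibrane.PseudoRiemannianMetric (𝓡 n) X) (g' : Bibrane.PseudoRiemannianMetric (𝓡 n) X')
    (F : Bibrane.ClosedTwoForm (𝓡 k) Y)
    (e : Y → X × X') (he : Manifold.IsSmoothEmbedding (𝓡 k) (Bibrane.prodModel n) ∞ e)
    (hbibrane : Bibrane.IsTopologicalBibrane g g' F e)
    (hint : Bibrane.IsIntegrable (𝓡 k) (Bibrane.Rplus g g' F e))
    {Λ : Type*} [NormedRing Λ] [NormedAlgebra ℝ Λ] {D : Type*}
    (V : Bibrane.AllowedVariation g g' F e Λ D) (σ : D)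
    (c : OpenPartialHomeomorph (X × X') (ModelProd (EuclideanSpace ℝ (Fin n))
      (EuclideanSpace ℝ (Fin n))))
    (hc : c ∈ IsManifold.maximalAtlas (Bibrane.prodModel n) ∞ (X × X'))
    (hσ : e (V.φ 0 σ) ∈ c.source) :
    V.boundaryTerm c σ = 0 :=
  Bibrane.boundaryTerm_eq_zero he.isImmersion hint V σ hc hσ
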